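/- Let $SE(2)=\mathbb R^2\rtimes SO(2)$ with $(\mathbf x,\mathbf R)\circ(\mathbf x',\mathbf R')=(\mathbf x+\mathbf R\mathbf x',\mathbf R\mathbf R')$ and Haar measure $dg=\frac1{4\pi^2}dx_1dx_2d\theta$, let $\Gamma=\mathbb Z^2$ be the subgroup of integral translations, and let $\mu$ be the finite invariant measure on the right coset space $\Gamma\backslash SE(2)$ normalized by Weil's formula $\int_{\Gamma\backslash SE(2)}\widetilde f\,d\mu=\int_{SE(2)}f(g)\,dg$, where $\widetilde f(\Gamma g)=\sum_{\gamma\in\Gamma}f(\gamma\circ g)$. For $f,f_1,f_2\in L^1(SE(2))$ and $\psi\in L^1(\Gamma\backslash SE(2),\mu)$ put $$(f_1\star f_2)(h)=\int_{SE(2)}f_1(g)f_2(g^{-1}\circ h)\,dg,\qquad(\psi\oslash f)(\Gamma g)=\int_{SE(2)}\psi(\Gamma h)f(h^{-1}\circ g)\,dh .$$ For $p>0$ and $g=(\mathbf x,\mathbf R)$ let $[U_p(g)\varphi](\mathbf u)=e^{-\mathrm i p\langle\mathbf u,\mathbf x\rangle}\varphi(\mathbf R^{T}\mathbf u)$ on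 $L^2(\mathbb S^1)$ with $\langle\varphi,\chi\rangle=\frac1{2\pi}\int_0^{2\pi}\varphi\,\overline{\chi}\,d\alpha$, let $\mathbf e_k(\cos\alpha,\sin\alpha)=e^{\mathrm i k\alpha}$ for $k\in\mathbb Z$, and $$\mathrm u_{mn}(g,p)=\langle U_p(g)\mathbf e_m,\mathbf e_n\rangle,\qquad \widehat f(p)=\int_{SE(2)}f(g)U_p(g^{-1})\,dg,\qquad \widehat f(p)_{nm}=\langle\widehat f(p)\mathbf e_n,\mathbf e_m\rangle .$$ Let $\{\psi_\ell:\ell\in\mathbb I\}$ be an orthonormal basis of $L^2(\Gamma\backslash SE(2),\mu)$. For a compact set $K\subseteq SE(2)$ put $$Q^\ell_K(p)_{mn}=\int_K\mathrm u_{mn}(g,p)\,\overline{\psi_\ell(\Gamma g)}\,dg .$$ **Theorem.** Let $f_1,f_2\in L^1(SE(2))$ with $\widetilde{|f_1|}\in L^2(\Gamma\backslash SE(2),\mu)$. Then: (1) The integral defining $f_1\star f_2$ converges absolutely almost everywhere, $f_1\star f_2\in L^1(SE(2))$, its absolute value has periodization $\widetilde{|f_1\star f_2|}\in L^2(\Gamma\backslash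 SE(2),\mu)$, and $\|\widetilde{|f_1\star f_2|}\|_{L^2(\mu)}\le\|\widetilde{|f_1|}\|_{L^2(\mu)}\|f_2\|_{L^1(SE(2))}$. (2) The integral defining $\widetilde{f_1}\oslash f_2$ converges absolutely almost everywhere, $\widetilde{f_1}\oslash f_2\in L^2(\Gamma\backslash SE(2),\mu)$, and $$\widetilde{f_1}\oslash f_2=\sum_{\ell\in\mathbb I}\Bigl(\sum_{n\in\mathbb Z}\sum_{m\in\mathbb Z}\sum_{k\in\mathbb Z}\int_0^\infty\widehat{f_1}(p)_{nk}\,\widehat{f_2}(p)_{km}\,Q^\ell(p)_{mn}\,p\,dp\Bigr)\psi_\ell ,$$ with unconditional convergence of the series over $\ell$ in $L^2(\Gamma\backslash SE(2),\mu)$. Here $Q^\ell(p)_{mn}=\int_{SE(2)}\mathrm u_{mn}(g,p)\overline{\psi_\ell(\Gamma g)}\,dg$, an integral which does not converge absolutely in general, is understood as a generalized (operator valued) function of $p$, the weak limit of $Q^\ell_K$ as $K$ exhausts $SE(2)$. That is, the coefficient in parentheses denotes $$\lim_{j\to\infty}\ \sum_{n\in\mathbb Z}\sum_{m\in\mathbb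 Z}\sum_{k\in\mathbb Z}\int_0^\infty\widehat{f_1}(p)_{nk}\,\widehat{f_2}(p)_{km}\,Q^\ell_{K_j}(p)_{mn}\,p\,dp ,$$ where $(K_j)$ is any sequence of compact sets such that every point of $SE(2)$ lies in $K_j$ for all large $j$; this limit exists and does not depend on the sequence. For every compact $K$ in place of $K_j$, the integrals over $p$ converge absolutely, so does for all $n,m$ the sum over $k$, and so does the sum over $(n,m)\in\mathbb Z^2$ of the sums over $k$. -/

import Mathlib

open MeasureTheory Filter Topology
open scoped ENNReal

noncomputable section

/-- The group `SE(2) = ℝ² ⋊ SO(2)` of planar rigid motions. The plane `ℝ²` is identified with `ℂ`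
and the rotation `R_θ ∈ SO(2)` with the unit complex number `exp(iθ)`, which acts on the plane by
multiplication. An element is a pair `(x, R)` of a translation and a rotation. -/
def SE2 : Type := ℂ × Circle

namespace SE2

instance : TopologicalSpace SE2 := inferInstanceAs (TopologicalSpace (ℂ × Circle))

instance : MeasurableSpace SE2 := borel SE2

instance : BorelSpace SE2 := ⟨rfl⟩

/-- The rigid motion `(x, R)`. -/
def mk (x : ℂ) (R : Circle) : SE2 := (x, R)

/-- The translation part `x ∈ ℝ²` of `(x, R)`. -/
def trans (g : SE2) : ℂ := Prod.fst g

/-- The rotation part `R ∈ SO(2)` of `(x, R)`. -/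
def rot (g : SE2) : Circle := Prod.snd g

@[ext] theorem ext {g h : SE2} (h₁ : g.trans = h.trans) (h₂ : g.rot = h.rot) : g = h :=
  Prod.ext h₁ h₂

/-- `(x, R) ∘ (x', R') = (x + R x', R R')` -/
instance : Mul SE2 := ⟨fun g h => mk (g.trans + (g.rot : ℂ) * h.trans) (g.rot * h.rot)⟩

instance : One SE2 := ⟨mk 0 1⟩

/-- `(x, R)⁻¹ = (- R⁻¹ x, R⁻¹)` -/
instance : Inv SE2 := ⟨fun g => mk (-(((g.rot)⁻¹ : Circle) : ℂ) * g.trans) (g.rot)⁻¹⟩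

@[simp] theorem trans_mk (x : ℂ) (R : Circle) : (mk x R).trans = x := rfl
@[simp] theorem rot_mk (x : ℂ) (R : Circle) : (mk x R).rot = R := rfl
@[simp] theorem trans_mul (g h : SE2) : (g * h).trans = g.trans + (g.rot : ℂ) * h.trans := rfl
@[simp] theorem rot_mul (g h : SE2) : (g * h).rot = g.rot * h.rot := rfl
@[simp] theorem trans_one : (1 : SE2).trans = 0 := rfl
@[simp] theorem rot_one : (1 : SE2).rot = 1 := rfl
@[simp] theorem trans_inv (g : SE2) :
    (g⁻¹).trans = -(((g.rot)⁻¹ : Circle) : ℂ) * g.trans := rfl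
@[simp] theorem rot_inv (g : SE2) : (g⁻¹).rot = (g.rot)⁻¹ := rfl

instance : Group SE2 where
  mul_assoc a b c := by
    ext1
    · simp only [trans_mul, rot_mul, Circle.coe_mul]; ring
    · simp [mul_assoc]
  one_mul a := by ext1 <;> simp
  mul_one a := by ext1 <;> simp
  inv_mul_cancel a := by ext1 <;> simp

theorem continuous_trans : Continuous trans := continuous_fst

theorem continuous_rot : Continuous rot := continuous_snd

theorem continuous_mk : Continuous (fun q : ℂ × Circle => mk q.1 q.2) := continuous_id

theorem continuous_mul_left (g : SE2) : Continuous (fun h : SE2 => g * h) :=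
  continuous_mk.comp (((continuous_const.add (continuous_const.mul continuous_trans))).prodMk
    (continuous_const.mul continuous_rot))

/-- The map `(x, θ) ↦ g(x, θ) = (x, R_θ)`. -/
def param (q : ℂ × ℝ) : SE2 := mk q.1 (Circle.exp q.2)

theorem measurable_param : Measurable param :=
  (continuous_mk.comp (continuous_fst.prodMk
    (Circle.exp.continuous.comp continuous_snd))).measurable

/-- The normalized Haar measure `dg = (4π²)⁻¹ dx₁ dx₂ dθ`, with `0 < θ ≤ 2π`. -/
def haar : Measure SE2 :=
  ENNReal.ofReal (1 / (4 * Real.pi ^ 2)) •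
    Measure.map param
      ((volume : Measure ℂ).prod ((volume : Measure ℝ).restrict (Set.Ioc 0 (2 * Real.pi))))

/-- The lattice `Γ = ℤ²` of integral translations, as a subgroup of `SE(2)`. -/
def lattice : Subgroup SE2 where
  carrier := {g | (∃ a b : ℤ, g.trans = (a : ℂ) + (b : ℂ) * Complex.I) ∧ g.rot = 1}
  mul_mem' := by
    rintro g h ⟨⟨a, b, h₁⟩, h₂⟩ ⟨⟨c, d, h₃⟩, h₄⟩
    refine ⟨⟨a + c, b + d, ?_⟩, by simp [h₂, h₄]⟩
    simp only [trans_mul, h₁, h₂, h₃, Circle.coe_one, Int.cast_add]; ring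
  one_mem' := ⟨⟨0, 0, by simp⟩, rfl⟩
  inv_mem' := by
    rintro g ⟨⟨a, b, h₁⟩, h₂⟩
    refine ⟨⟨-a, -b, ?_⟩, by simp [h₂]⟩
    simp only [trans_inv, h₁, h₂, inv_one, Circle.coe_one, Int.cast_neg]; ring

/-- The right coset space `Γ \ SE(2) = {Γ g : g ∈ SE(2)}`, with the quotient `σ`-algebra. -/
abbrev Coset : Type := Quotient (QuotientGroup.rightRel lattice)

/-- The canonical map `g ↦ Γ g`. -/
def toCoset (g : SE2) : Coset := Quotient.mk _ g

/-- The fundamental domain `[0,1)² × SO(2)` of the lattice. -/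
def domain : Set SE2 :=
  {g | g.trans.re ∈ Set.Ico (0 : ℝ) 1 ∧ g.trans.im ∈ Set.Ico (0 : ℝ) 1}

/-- The invariant measure `μ` on `Γ \ SE(2)`, normalized by Weil's formula: the image of the Haar
measure of a fundamental domain. Weil's formula itself is `lintegral_cosetMeasure`. -/
def cosetMeasure : Measure Coset := Measure.map toCoset (haar.restrict domain)

theorem measurable_toCoset : Measurable toCoset := measurable_quotient_mk''

theorem toCoset_mul (γ : lattice) (g : SE2) : toCoset ((γ : SE2) * g) = toCoset g :=
  Quotient.sound ⟨γ, rfl⟩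

/-- The Haar measure is invariant under left translation by the lattice. -/
theorem measurePreserving_lattice (γ : lattice) :
    MeasurePreserving (fun g : SE2 => (γ : SE2) * g) haar haar := by
  refine ⟨(continuous_mul_left _).measurable, ?_⟩
  have hrot : (γ : SE2).rot = 1 := γ.2.2
  have hcomm : (fun g : SE2 => (γ : SE2) * g) ∘ param =
      param ∘ Prod.map (fun x : ℂ => (γ : SE2).trans + x) id := by
    funext q
    exact SE2.ext (by simp [param, hrot]) (by simp [param, hrot])
  have hmp : MeasurePreserving (Prod.map (fun x : ℂ => (γ : SE2).trans + x) (id : ℝ → ℝ))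
      ((volume : Measure ℂ).prod ((volume : Measure ℝ).restrict (Set.Ioc 0 (2 * Real.pi))))
      ((volume : Measure ℂ).prod ((volume : Measure ℝ).restrict (Set.Ioc 0 (2 * Real.pi)))) :=
    (measurePreserving_add_left _ _).prod (MeasurePreserving.id _)
  rw [haar, Measure.map_smul,
    Measure.map_map (continuous_mul_left _).measurable measurable_param, hcomm,
    ← Measure.map_map measurable_param hmp.measurable, hmp.map_eq]

instance : MeasurableConstSMul lattice SE2 :=
  ⟨fun γ => (continuous_mul_left (γ : SE2)).measurable⟩

instance : SMulInvariantMeasure lattice SE2 haar :=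
  ⟨fun γ _ hs => (measurePreserving_lattice γ).measure_preimage hs.nullMeasurableSet⟩

instance : Countable lattice := by
  have h : ∀ γ : lattice, ∃ q : ℤ × ℤ, (γ : SE2).trans = (q.1 : ℂ) + (q.2 : ℂ) * Complex.I :=
    fun γ => γ.2.1.elim fun a ha => ha.elim fun b hb => ⟨(a, b), hb⟩
  choose q hq using h
  have hinj : Function.Injective q := fun γ δ hγδ =>
    Subtype.ext (SE2.ext (by rw [hq γ, hq δ, hγδ]) (γ.2.2.trans δ.2.2.symm))
  exact hinj.countable

theorem measurableSet_domain : MeasurableSet domain :=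
  (((Complex.continuous_re.comp continuous_trans).measurable) measurableSet_Ico).inter
    (((Complex.continuous_im.comp continuous_trans).measurable) measurableSet_Ico)

theorem isFundamentalDomain_domain : IsFundamentalDomain lattice domain haar := by
  refine IsFundamentalDomain.mk' measurableSet_domain.nullMeasurableSet fun g => ?_
  refine ⟨⟨mk (((-⌊g.trans.re⌋ : ℤ) : ℂ) + ((-⌊g.trans.im⌋ : ℤ) : ℂ) * Complex.I) 1,
    ⟨⟨_, _, rfl⟩, rfl⟩⟩, ?_, ?_⟩
  · simp only [Subgroup.smul_def, smul_eq_mul, domain, Set.mem_ofPred_eq, trans_mul, trans_mk,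
      rot_mk, Circle.coe_one, one_mul]
    simp only [Complex.add_re, Complex.add_im, Complex.intCast_re, Complex.intCast_im,
      Complex.mul_re, Complex.mul_im, Complex.I_re, Complex.I_im, Set.mem_Ico]
    push_cast
    have h₁ := Int.floor_le g.trans.re
    have h₂ := Int.lt_floor_add_one g.trans.re
    have h₃ := Int.floor_le g.trans.im
    have h₄ := Int.lt_floor_add_one g.trans.im
    refine ⟨⟨?_, ?_⟩, ⟨?_, ?_⟩⟩ <;> linarith
  · rintro ⟨γ, ⟨⟨a, b, hγ⟩, hr⟩⟩ hmem
    simp only [Subgroup.smul_def, smul_eq_mul, domain, Set.mem_ofPred_eq, trans_mul, hγ,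
      hr, Circle.coe_one, one_mul] at hmem
    simp only [Complex.add_re, Complex.add_im, Complex.intCast_re, Complex.intCast_im,
      Complex.mul_re, Complex.mul_im, Complex.I_re, Complex.I_im, Set.mem_Ico] at hmem
    obtain ⟨⟨h₁, h₂⟩, ⟨h₃, h₄⟩⟩ := hmem
    have ha : ⌊g.trans.re⌋ = -a := by
      rw [Int.floor_eq_iff]; push_cast; constructor <;> linarith
    have hb : ⌊g.trans.im⌋ = -b := by
      rw [Int.floor_eq_iff]; push_cast; constructor <;> linarith
    refine Subtype.ext (SE2.ext ?_ hr)
    simp [hγ, ha, hb]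

/-- `f̃(Γ g) = ∑_{γ ∈ Γ} f(γ g)` for `f` with values in a commutative topological monoid. -/
def periodization {M : Type*} [AddCommMonoid M] [TopologicalSpace M] (f : SE2 → M) : Coset → M :=
  Quotient.lift (fun g => ∑' γ : lattice, f ((γ : SE2) * g)) (by
    rintro g h ⟨δ, rfl⟩
    refine Eq.trans ?_ ((Equiv.mulRight δ).tsum_eq fun γ : lattice => f ((γ : SE2) * h))
    refine tsum_congr fun γ => ?_
    simp [Subgroup.smul_def, mul_assoc])

/-- Weil's formula `∫_{Γ \ SE(2)} f̃ dμ = ∫_{SE(2)} f dg`, which determines `μ`. -/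
theorem lintegral_cosetMeasure {f : SE2 → ℝ≥0∞} (hf : Measurable f) :
    ∫⁻ x, periodization f x ∂cosetMeasure = ∫⁻ g, f g ∂haar := by
  have hm : ∀ γ : lattice, Measurable fun g : SE2 => f ((γ : SE2) * g) := fun γ =>
    hf.comp (continuous_mul_left _).measurable
  have hp : Measurable (periodization f) :=
    measurable_from_quotient.2 (Measurable.tsum hm)
  rw [cosetMeasure, lintegral_map hp measurable_toCoset,
    isFundamentalDomain_domain.lintegral_eq_tsum'' f]
  exact lintegral_tsum fun γ => (hm γ).aemeasurable

/-- The periodization of `|f|`, with values in `[0,∞]`, for a complex function `f`. -/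
def absPeriodization (f : SE2 → ℂ) : Coset → ℝ≥0∞ := periodization fun g => ‖f g‖ₑ

/-- `(f₁ ⋆ f₂)(h) = ∫ f₁(g) f₂(g⁻¹ h) dg` -/
def conv (f₁ f₂ : SE2 → ℂ) (h : SE2) : ℂ := ∫ g, f₁ g * f₂ (g⁻¹ * h) ∂haar

/-- `(ψ ⊘ f)(Γ g) = ∫ ψ(Γ h) f(h⁻¹ g) dh` -/
def cosetConv (ψ : Coset → ℂ) (f : SE2 → ℂ) : Coset → ℂ :=
  Quotient.lift (fun g => ∫ h, ψ (toCoset h) * f (h⁻¹ * g) ∂haar) (by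
    rintro g g' ⟨δ, rfl⟩
    have hemb : MeasurableEmbedding (fun h : SE2 => (δ : SE2) * h) :=
      measurableEmbedding_const_smul δ
    have := (measurePreserving_lattice δ).integral_comp hemb
      (fun h => ψ (toCoset h) * f (h⁻¹ * ((δ : SE2) * g')))
    refine this.symm.trans (integral_congr_ae (Eventually.of_forall fun h => ?_))
    simp [toCoset_mul, mul_assoc])

/-- The representation `[U_p(g) φ](u) = exp(-i p ⟨u, x⟩) φ(R⁻¹ u)`, `g = (x, R)`, on functions on
the unit circle. -/
def rep (p : ℝ) (g : SE2) (φ : Circle → ℂ) (u : Circle) : ℂ :=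
  Complex.exp (-Complex.I * p * (inner ℝ (u : ℂ) g.trans : ℝ)) * φ ((g.rot)⁻¹ * u)

/-- `⟨φ, χ⟩ = (2π)⁻¹ ∫_0^{2π} φ(u_α) conj (χ(u_α)) dα`, `u_α = exp(iα)`. -/
def circleInner (φ χ : Circle → ℂ) : ℂ :=
  (1 / (2 * Real.pi) : ℂ) *
    ∫ α in (0 : ℝ)..(2 * Real.pi), φ (Circle.exp α) * starRingEnd ℂ (χ (Circle.exp α))

/-- `e_k(u_α) = exp(i k α)` -/
def fourierBasis (k : ℤ) (u : Circle) : ℂ := (u : ℂ) ^ k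

/-- The matrix element `u_{mn}(g,p) = ⟨U_p(g) e_m, e_n⟩`. -/
def repEntry (p : ℝ) (m n : ℤ) (g : SE2) : ℂ :=
  circleInner (rep p g (fourierBasis m)) (fourierBasis n)

/-- The Fourier transform `f̂(p) φ = ∫ f(g) U_p(g⁻¹) φ dg`. -/
def fourierOp (f : SE2 → ℂ) (p : ℝ) (φ : Circle → ℂ) (u : Circle) : ℂ :=
  ∫ g, f g * rep p g⁻¹ φ u ∂haar

/-- The matrix element `f̂(p)_{nm} = ⟨f̂(p) e_n, e_m⟩`. -/
def fourierEntry (f : SE2 → ℂ) (p : ℝ) (n m : ℤ) : ℂ :=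
  circleInner (fourierOp f p (fourierBasis n)) (fourierBasis m)

/-- The integral of `u_{mn}(g,p) conj (ψ(Γ g))` over a subset `K` of `SE(2)`. The integral over all
of `SE(2)` does not converge absolutely (for the characters of the torus it is a Dirac mass in `p`).
The kernel `Q(p)`, an operator valued generalized function of `p`, is the weak limit of its
truncations `Q_K(p)` as `K` exhausts `SE(2)`: its pairing `∑_{n,m} ∫ A(p)_{nm} Q(p)_{mn} p dp` with an
operator valued function `A` is the limit of the pairings of `A` with the truncations. -/
def kernelOn (K : Set SE2) (ψ : Coset → ℂ) (p : ℝ) (m n : ℤ) : ℂ :=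
  ∫ g in K, repEntry p m n g * starRingEnd ℂ (ψ (toCoset g)) ∂haar

/-- The integrand `f̂₁(p)_{nk} f̂₂(p)_{km} Q(p)_{mn} p`, with `Q` truncated to `K`. -/
def coeffIntegrand (K : Set SE2) (ψ : Coset → ℂ) (f₁ f₂ : SE2 → ℂ) (n m k : ℤ) (p : ℝ) : ℂ :=
  fourierEntry f₁ p n k * fourierEntry f₂ p k m * kernelOn K ψ p m n * (p : ℂ)

/-- The term `∫_0^∞ f̂₁(p)_{nk} f̂₂(p)_{km} Q(p)_{mn} p dp`, with `Q` truncated to `K`. -/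
def coeffTerm (K : Set SE2) (ψ : Coset → ℂ) (f₁ f₂ : SE2 → ℂ) (n m k : ℤ) : ℂ :=
  ∫ p in Set.Ioi (0 : ℝ), coeffIntegrand K ψ f₁ f₂ n m k p

/-- An exhaustion of `SE(2)` by compact sets: every point lies in all but finitely many of them. -/
def IsExhaustion (K : ℕ → Set SE2) : Prop :=
  (∀ j, IsCompact (K j)) ∧ ∀ g, ∀ᶠ j in atTop, g ∈ K j

end SE2

end

/-! ### Euclidean Plancherel formula on `L¹ ∩ L²` -/

section Plancherel

open FourierTransform SchwartzMap

variable {E : Type*} [NormedAddCommGroup E] [InnerProductSpace ℝ E] [FiniteDimensional ℝ E]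
  [MeasurableSpace E] [BorelSpace E]

/-! Translating the integration variable by `γ` in each term of the periodization of `f₁ ⋆ f₂` shows
that it equals `f̃₁ ⊘ f₂` wherever the corresponding integral of absolute values is finite
(`cosetConv_eq_periodization_conv`). That integral is `|f₁|~ ⊘ |f₂|`, which Young's inequality
`lintegral_cosetLConv_sq_le` controls in `L²`. By Weil's formula the coefficient of `f̃₁ ⊘ f₂` at
`ψ_ℓ` is then the absolutely convergent integral of `(f₁ ⋆ f₂)(g) conj ψ_ℓ(Γg)` over the group.

It remains to compute this integral on the Fourier side. The function `ψ_ℓ(Γg)` is periodic, so it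
is first cut off to a compact set `K`. The truncation lies in `L¹ ∩ L²`, and `Q_K` is the conjugate
of its Fourier transform (`kernelOn_eq`). Since `f₁ ⋆ f₂` also lies in `L¹ ∩ L²`, the polarized
Plancherel formula applies, and the convolution theorem `hasSum_fourierEntry_mul` expands its
entries into the sums over `k`. Letting `K` exhaust the group is dominated convergence.

Plancherel's formula for the group comes from Parseval in the rotation variable, Plancherel on the
plane, polar coordinates, and Parseval on each circle of frequencies: for fixed `m`, the entries
`f̂(p)_{nm}` are conjugates of circle Fourier coefficients in `n`. -/

theorem continuous_fourier_of_integrable {f : E → ℂ} (hf : Integrable f) : Continuous (𝓕 f) :=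
  VectorFourier.fourierIntegral_continuous Real.continuous_fourierChar
    continuous_inner hf

/-- The Fourier integral of a function in `L¹ ∩ L²` represents its `L²` Fourier transform. -/
theorem fourier_toLp_ae_eq {f : E → ℂ} (hf : Integrable f) (hf₂ : MemLp f 2) :
    ((𝓕 (hf₂.toLp f) : Lp ℂ 2 (volume : Measure E)) : E → ℂ) =ᵐ[volume] 𝓕 f := by
  -- Both sides are locally integrable, so testing against smooth compactly supported functions
  -- suffices.
  refine ae_eq_of_integral_contDiff_smul_eq ((Lp.memLp _).locallyIntegrable one_le_two)
    (continuous_fourier_of_integrable hf).locallyIntegrable fun g hg hgc => ?_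
  have hg₁ : HasCompactSupport (Complex.ofRealCLM ∘ g) := hgc.comp_left rfl
  have hg₂ : ContDiff ℝ (⊤ : ℕ∞) (Complex.ofRealCLM ∘ g) := Complex.ofRealCLM.contDiff.comp hg
  let φ : 𝓢(E, ℂ) := hg₁.toSchwartzMap hg₂
  have h₁ : ∫ x, g x • (𝓕 (hf₂.toLp f) : Lp ℂ 2 (volume : Measure E)) x
      = ((𝓕 (hf₂.toLp f) : Lp ℂ 2 (volume : Measure E)) : 𝓢'(E, ℂ)) φ := by
    rw [Lp.toTemperedDistribution_apply]
    exact integral_congr_ae (Eventually.of_forall fun x => by simp [φ])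
  rw [h₁, ← Lp.fourier_toTemperedDistribution_eq, TemperedDistribution.fourier_apply,
    Lp.toTemperedDistribution_apply]
  -- The multiplication formula `∫ 𝓕φ · f = ∫ φ · 𝓕f`.
  have h₂ := VectorFourier.integral_fourierIntegral_smul_eq_flip (μ := (volume : Measure E))
    (ν := (volume : Measure E)) (L := innerₗ E) (f := φ) (g := f) Real.continuous_fourierChar
    continuous_inner φ.integrable hf
  have h₃ : ∫ x, (𝓕 φ) x • (hf₂.toLp f) x = ∫ x, (𝓕 φ) x • f x :=
    integral_congr_ae (by filter_upwards [hf₂.coeFn_toLp] with x hx using by rw [hx])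
  rw [h₃]
  refine Eq.trans (Eq.trans ?_ h₂) ?_
  · rfl
  · rw [flip_innerₗ]
    exact integral_congr_ae (Eventually.of_forall fun x => by
      change φ x • 𝓕 f x = _
      simp [φ])

/-- Plancherel's formula for the Fourier integral on `L¹ ∩ L²`. -/
theorem lintegral_enorm_sq_fourier {f : E → ℂ} (hf : Integrable f) (hf₂ : MemLp f 2) :
    ∫⁻ ξ, ‖𝓕 f ξ‖ₑ ^ 2 = ∫⁻ x, ‖f x‖ₑ ^ 2 := by
  have key : ∀ h : Lp ℂ 2 (volume : Measure E), ∫⁻ x, ‖h x‖ₑ ^ 2 = ‖h‖ₑ ^ 2 := fun h => by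
    rw [Lp.enorm_def, eLpNorm_eq_lintegral_rpow_enorm_toReal two_ne_zero ENNReal.ofNat_ne_top]
    rw [← ENNReal.rpow_natCast, ← ENNReal.rpow_mul]
    simp
  have h := Lp.norm_fourier_eq (hf₂.toLp f)
  have h' : ‖(𝓕 (hf₂.toLp f) : Lp ℂ 2 (volume : Measure E))‖ₑ = ‖hf₂.toLp f‖ₑ := by
    rw [← ofReal_norm, ← ofReal_norm, h]
  calc ∫⁻ ξ, ‖𝓕 f ξ‖ₑ ^ 2 = ‖(𝓕 (hf₂.toLp f) : Lp ℂ 2 (volume : Measure E))‖ₑ ^ 2 := by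
        rw [← key]
        exact lintegral_congr_ae (by
          filter_upwards [fourier_toLp_ae_eq hf hf₂] with x hx using by rw [hx])
    _ = ∫⁻ x, ‖f x‖ₑ ^ 2 := by
        rw [h', ← key]
        exact lintegral_congr_ae (by filter_upwards [hf₂.coeFn_toLp] with x hx using by rw [hx])

end Plancherel

/-! ### Invariant measure and Parseval's formula on the circle -/

noncomputable section

instance : MeasurableSpace Circle := borel Circle

instance : BorelSpace Circle := ⟨rfl⟩

instance fact_two_pi_pos : Fact (0 < 2 * Real.pi) := ⟨Real.two_pi_pos⟩

theorem enorm_sq_eq_ofReal (z : ℂ) : ‖z‖ₑ ^ 2 = ENNReal.ofReal (‖z‖ ^ 2) := by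
  rw [← ofReal_norm, ENNReal.ofReal_pow (norm_nonneg z)]

namespace Circle

/-- The rotation invariant probability measure on the unit circle. -/
def probHaar : Measure Circle :=
  Measure.map AddCircle.homeomorphCircle' (AddCircle.haarAddCircle (T := 2 * Real.pi))

theorem measurePreserving_homeomorphCircle' :
    MeasurePreserving AddCircle.homeomorphCircle' (AddCircle.haarAddCircle (T := 2 * Real.pi))
      probHaar :=
  ⟨AddCircle.homeomorphCircle'.continuous.measurable, rfl⟩

instance : IsProbabilityMeasure probHaar :=
  Measure.isProbabilityMeasure_map AddCircle.homeomorphCircle'.continuous.aemeasurable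

instance : probHaar.IsMulLeftInvariant := by
  refine ⟨fun c => ?_⟩
  obtain ⟨a, rfl⟩ := AddCircle.homeomorphCircle'.surjective c
  rw [probHaar, Measure.map_map (continuous_const_mul _).measurable
    AddCircle.homeomorphCircle'.continuous.measurable]
  have : (AddCircle.homeomorphCircle' a * ·) ∘ AddCircle.homeomorphCircle'
      = AddCircle.homeomorphCircle' ∘ (a + ·) := by
    funext b
    exact (Real.Angle.toCircle_add a b).symm
  rw [this, ← Measure.map_map AddCircle.homeomorphCircle'.continuous.measurable
    (measurable_const_add _), map_add_left_eq_self]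

instance : probHaar.IsInvInvariant := by
  refine ⟨?_⟩
  rw [Measure.inv, probHaar, Measure.map_map continuous_inv.measurable
    AddCircle.homeomorphCircle'.continuous.measurable]
  have : Inv.inv ∘ AddCircle.homeomorphCircle'
      = AddCircle.homeomorphCircle' ∘ (Neg.neg : AddCircle (2 * Real.pi) → _) := by
    funext b
    exact (Real.Angle.toCircle_neg b).symm
  rw [this, ← Measure.map_map AddCircle.homeomorphCircle'.continuous.measurable
    measurable_neg, Measure.map_neg_eq_self]

theorem integral_probHaar (F : Circle → ℂ) (t : ℝ) :
    ∫ u, F u ∂probHaar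
      = (1 / (2 * Real.pi) : ℂ) * ∫ α in t..(t + 2 * Real.pi), F (Circle.exp α) := by
  rw [← measurePreserving_homeomorphCircle'.integral_comp
    AddCircle.homeomorphCircle'.measurableEmbedding, AddCircle.integral_haarAddCircle,
    ← AddCircle.intervalIntegral_preimage _ t, Complex.real_smul]
  congr 1
  push_cast; rw [one_div]

/-- The free base point `t` serves two conventions for the angle: `(0, 2π]` in `haar` and `(-π, π)`
in polar coordinates. -/
theorem lintegral_probHaar (F : Circle → ℝ≥0∞) (t : ℝ) :
    ENNReal.ofReal (2 * Real.pi) * ∫⁻ u, F u ∂probHaar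
      = ∫⁻ α in Set.Ioc t (t + 2 * Real.pi), F (Circle.exp α) := by
  rw [← measurePreserving_homeomorphCircle'.lintegral_comp_emb
    AddCircle.homeomorphCircle'.measurableEmbedding, ← smul_eq_mul, ← lintegral_smul_measure,
    ← AddCircle.volume_eq_smul_haarAddCircle, ← AddCircle.lintegral_preimage _ t]
  rfl

theorem map_exp_volume :
    Measure.map Circle.exp ((volume : Measure ℝ).restrict (Set.Ioc 0 (2 * Real.pi)))
      = ENNReal.ofReal (2 * Real.pi) • probHaar := by
  refine Measure.ext fun s hs => ?_
  have h := lintegral_probHaar (s.indicator 1) 0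
  rw [lintegral_indicator_one hs, zero_add] at h
  rw [Measure.smul_apply, smul_eq_mul, h, ← lintegral_indicator_one hs,
    lintegral_map (measurable_one.indicator hs) Circle.exp.continuous.measurable]

end Circle

namespace SE2

open Circle

theorem circleInner_eq (φ χ : Circle → ℂ) :
    circleInner φ χ = ∫ u, φ u * starRingEnd ℂ (χ u) ∂probHaar := by
  rw [circleInner, integral_probHaar _ 0, zero_add]

theorem continuous_fourierBasis (k : ℤ) : Continuous (fourierBasis k) := by
  have : fourierBasis k = fun u => ((u ^ k : Circle) : ℂ) := by
    funext u; simp [fourierBasis]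
  rw [this]
  exact continuous_subtype_val.comp (continuous_zpow k)

theorem memLp_of_continuous {φ : Circle → ℂ} (hφ : Continuous φ) : MemLp φ 2 probHaar :=
  hφ.memLp_of_hasCompactSupport (HasCompactSupport.of_compactSpace _)

/-- **Parseval's formula** for square integrable functions on the circle. -/
theorem hasSum_circleInner_mul {φ χ : Circle → ℂ} (hφ : MemLp φ 2 probHaar)
    (hχ : MemLp χ 2 probHaar) :
    HasSum (fun k : ℤ => circleInner φ (fourierBasis k) *
      starRingEnd ℂ (circleInner χ (fourierBasis k))) (circleInner φ χ) := by
  let e := AddCircle.homeomorphCircle'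
  let L : ∀ φ : Circle → ℂ, MemLp φ 2 probHaar →
      Lp ℂ 2 (AddCircle.haarAddCircle (T := 2 * Real.pi)) := fun φ h =>
    (h.comp_measurePreserving measurePreserving_homeomorphCircle').toLp
  have hL : ∀ φ h, L φ h =ᵐ[AddCircle.haarAddCircle] fun t => φ (e t) := fun φ h =>
    (h.comp_measurePreserving measurePreserving_homeomorphCircle').coeFn_toLp
  have hinner : ∀ (φ χ : Circle → ℂ) (h : MemLp φ 2 probHaar) (h' : MemLp χ 2 probHaar),
      inner ℂ (L χ h') (L φ h) = circleInner φ χ := fun φ χ h h' => by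
    rw [circleInner_eq, ← measurePreserving_homeomorphCircle'.integral_comp
      e.measurableEmbedding, L2.inner_def]
    refine integral_congr_ae ?_
    filter_upwards [hL φ h, hL χ h'] with t h₁ h₂
    rw [RCLike.inner_apply, h₁, h₂]
  have hb : ∀ k, MemLp (fourierBasis k) 2 probHaar := fun k =>
    memLp_of_continuous (continuous_fourierBasis k)
  have hbasis : ∀ k : ℤ, (_root_.fourierBasis (T := 2 * Real.pi) k) = L _ (hb k) := fun k => by
    rw [coe_fourierBasis]
    refine Lp.ext ?_
    filter_upwards [coeFn_fourierLp 2 k, hL _ (hb k)] with t h₁ h₂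
    rw [h₁, h₂]
    induction t using QuotientAddGroup.induction_on with | H x => ?_
    change fourier k (x : AddCircle (2 * Real.pi)) = ((Circle.exp x : Circle) : ℂ) ^ k
    rw [fourier_coe_apply, Circle.coe_exp, ← Complex.exp_int_mul]
    congr 1
    have : (Real.pi : ℂ) ≠ 0 := by exact_mod_cast Real.pi_ne_zero
    push_cast
    field_simp
  have h := (_root_.fourierBasis (T := 2 * Real.pi)).hasSum_inner_mul_inner (L χ hχ) (L φ hφ)
  rw [hinner φ χ hφ hχ] at h
  refine h.congr_fun fun k => ?_
  rw [hbasis, hinner φ _ hφ (hb k), ← inner_conj_symm, hinner χ _ hχ (hb k), mul_comm]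

/-- Parseval on the diagonal, put in `[0,∞]` so that later interchanges of sums and integrals need
no summability. -/
theorem tsum_enorm_circleInner_sq {φ : Circle → ℂ} (hφ : MemLp φ 2 probHaar) :
    ∑' k : ℤ, ‖circleInner φ (fourierBasis k)‖ₑ ^ 2 = ∫⁻ u, ‖φ u‖ₑ ^ 2 ∂probHaar := by
  have h := hasSum_circleInner_mul hφ hφ
  have hsq : ∀ z : ℂ, z * starRingEnd ℂ z = ((‖z‖ ^ 2 : ℝ) : ℂ) := fun z => by
    rw [Complex.mul_conj, Complex.normSq_eq_norm_sq]
  have hint : Integrable (fun u => ‖φ u‖ ^ 2) probHaar := hφ.norm.integrable_sq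
  simp only [hsq, circleInner_eq φ φ, integral_complex_ofReal] at h
  have h' := Complex.hasSum_ofReal.1 h
  simp only [enorm_sq_eq_ofReal]
  rw [← ENNReal.ofReal_tsum_of_nonneg (fun k => sq_nonneg _) h'.summable, h'.tsum_eq,
    ofReal_integral_eq_lintegral_ofReal hint (Eventually.of_forall fun u => sq_nonneg _)]

end SE2

end

/-! ### Invariance of the Haar measure and of the coset measure -/

noncomputable section

namespace SE2

open Circle

instance : SecondCountableTopology SE2 := inferInstanceAs (SecondCountableTopology (ℂ × Circle))

instance : T2Space SE2 := inferInstanceAs (T2Space (ℂ × Circle))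

theorem continuous_coe_circle : Continuous fun u : Circle => (u : ℂ) := continuous_subtype_val

theorem continuous_coe_rot : Continuous fun g : SE2 => (g.rot : ℂ) :=
  continuous_subtype_val.comp continuous_rot

instance : ContinuousMul SE2 :=
  ⟨continuous_mk.comp (((continuous_trans.comp continuous_fst).add
    ((continuous_coe_rot.comp continuous_fst).mul (continuous_trans.comp continuous_snd))).prodMk
    ((continuous_rot.comp continuous_fst).mul (continuous_rot.comp continuous_snd)))⟩

instance : ContinuousInv SE2 :=
  ⟨continuous_mk.comp
    (((continuous_subtype_val.comp continuous_rot.inv).neg.mul continuous_trans).prodMk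
      continuous_rot.inv)⟩

/-- Rigid motions as pairs of a rotation and a translation. -/
def ofPair (q : Circle × ℂ) : SE2 := mk q.2 q.1

theorem continuous_ofPair : Continuous ofPair :=
  continuous_mk.comp (continuous_snd.prodMk continuous_fst)

theorem measurableEmbedding_ofPair : MeasurableEmbedding ofPair :=
  (Homeomorph.mk ⟨ofPair, fun g => (g.rot, g.trans), fun _ => rfl, fun _ => rfl⟩
    continuous_ofPair (continuous_rot.prodMk continuous_trans)).measurableEmbedding

/-- The constant is `2π / (4π²)`. Putting the rotation first makes inversion a skew product over the
circle, and the invariances of `haar` reduce to those of the two factors. -/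
theorem haar_eq : haar = ENNReal.ofReal (1 / (2 * Real.pi)) •
    Measure.map ofPair (probHaar.prod (volume : Measure ℂ)) := by
  have hparam : param = ofPair ∘ Prod.swap ∘ Prod.map id Circle.exp := rfl
  have hprod : Measure.map (Prod.map id Circle.exp)
      ((volume : Measure ℂ).prod ((volume : Measure ℝ).restrict (Set.Ioc 0 (2 * Real.pi))))
      = ENNReal.ofReal (2 * Real.pi) • (volume : Measure ℂ).prod probHaar := by
    rw [← Measure.map_prod_map _ _ measurable_id Circle.exp.continuous.measurable,
      Measure.map_id, map_exp_volume, Measure.prod_smul_right]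
  have hexp : Measurable (Prod.map (id : ℂ → ℂ) Circle.exp) :=
    measurable_id.prodMap Circle.exp.continuous.measurable
  rw [haar, hparam, ← Measure.map_map continuous_ofPair.measurable
    (measurable_swap.comp hexp), ← Measure.map_map measurable_swap hexp, hprod,
    Measure.map_smul, Measure.map_smul, Measure.prod_swap, smul_smul,
    ← ENNReal.ofReal_mul (by positivity)]
  congr 2
  have := Real.pi_ne_zero
  field_simp
  norm_num

instance : SFinite haar := by rw [haar_eq]; infer_instance

theorem measurePreserving_haar {T : SE2 → SE2} {S : Circle × ℂ → Circle × ℂ}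
    (hS : MeasurePreserving S (probHaar.prod volume) (probHaar.prod volume))
    (hT : Measurable T) (h : T ∘ ofPair = ofPair ∘ S) : MeasurePreserving T haar haar := by
  refine ⟨hT, ?_⟩
  rw [haar_eq, Measure.map_smul, Measure.map_map hT continuous_ofPair.measurable, h,
    ← Measure.map_map continuous_ofPair.measurable hS.measurable, hS.map_eq]

theorem measurePreserving_circle_mul (R : Circle) :
    MeasurePreserving (fun x : ℂ => (R : ℂ) * x) volume volume :=
  (rotation R).measurePreserving

instance : haar.IsMulLeftInvariant := by
  refine ⟨fun g => (measurePreserving_haar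
    (S := Prod.map (g.rot * ·) fun x => g.trans + (g.rot : ℂ) * x) ?_
    (continuous_const_mul g).measurable rfl).map_eq⟩
  exact (measurePreserving_mul_left _ _).prod
    ((measurePreserving_add_left volume g.trans).comp (measurePreserving_circle_mul g.rot))

instance : haar.IsInvInvariant := by
  refine ⟨(measurePreserving_haar
    (S := fun q => (q.1⁻¹, -((q.1⁻¹ : Circle) : ℂ) * q.2)) ?_
    continuous_inv.measurable rfl).map_eq⟩
  refine (Measure.measurePreserving_inv probHaar).skew_product
    (g := fun R x => -((R⁻¹ : Circle) : ℂ) * x) ?_ (Eventually.of_forall fun R => ?_)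
  · have h : Continuous fun q : Circle × ℂ => ((q.1⁻¹ : Circle) : ℂ) :=
      continuous_coe_circle.comp continuous_fst.inv
    exact (h.neg.mul continuous_snd).measurable
  -- `-R⁻¹` is again a unit complex number, so each fibre map is a rotation of the plane.
  · have h : (fun x : ℂ => -((R⁻¹ : Circle) : ℂ) * x) = fun x => ((-R⁻¹ : Circle) : ℂ) * x := by
      simp
    rw [h]
    exact (measurePreserving_circle_mul _).map_eq

/-- Unimodularity: `g k = (k⁻¹ g⁻¹)⁻¹` is composed of inversions and a left translation. -/
theorem measurePreserving_mul_right_haar (k : SE2) :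
    MeasurePreserving (fun g => g * k) haar haar := by
  have h := (Measure.measurePreserving_inv haar).comp ((measurePreserving_mul_left haar k⁻¹).comp
    (Measure.measurePreserving_inv haar))
  convert h using 2 with g
  simp

theorem lintegral_haar {f : SE2 → ℝ≥0∞} (hf : Measurable f) :
    ∫⁻ g, f g ∂haar = ENNReal.ofReal (1 / (2 * Real.pi)) *
      ∫⁻ R, ∫⁻ x, f (mk x R) ∂volume ∂probHaar := by
  rw [haar_eq, lintegral_smul_measure, measurableEmbedding_ofPair.lintegral_map,
    lintegral_prod (fun q => f (ofPair q)) (hf.comp continuous_ofPair.measurable).aemeasurable,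
    smul_eq_mul]
  rfl

theorem integrable_haar_iff {f : SE2 → ℂ} :
    Integrable f haar ↔ Integrable (fun q => f (ofPair q)) (probHaar.prod volume) := by
  rw [haar_eq, integrable_smul_measure (by simp; positivity) ENNReal.ofReal_ne_top,
    measurableEmbedding_ofPair.integrable_map_iff]
  rfl

theorem integral_haar {f : SE2 → ℂ} :
    ∫ g, f g ∂haar = (1 / (2 * Real.pi) : ℂ) *
      ∫ q, f (ofPair q) ∂(probHaar.prod volume) := by
  rw [haar_eq, integral_smul_measure, measurableEmbedding_ofPair.integral_map,
    ENNReal.toReal_ofReal (by positivity), Complex.real_smul]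
  push_cast; rfl

/-! ### The coset space -/

theorem measurable_periodization {f : SE2 → ℝ≥0∞} (hf : Measurable f) :
    Measurable (periodization f) :=
  measurable_from_quotient.2
    (Measurable.tsum fun γ : lattice => hf.comp (continuous_mul_left (γ : SE2)).measurable)

theorem periodization_mul_comp (f : SE2 → ℝ≥0∞) (a : Coset → ℝ≥0∞) :
    periodization (fun g => f g * a (toCoset g)) = fun x => periodization f x * a x := by
  funext x
  induction x using Quotient.inductionOn with | h g => ?_
  change ∑' γ : lattice, f ((γ : SE2) * g) * a (toCoset ((γ : SE2) * g))
    = (∑' γ : lattice, f ((γ : SE2) * g)) * a (toCoset g)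
  simp_rw [toCoset_mul, ENNReal.tsum_mul_right]

/-- Weil's formula for the product of a function on the group with one on the coset space. -/
theorem lintegral_mul_comp_toCoset {f : SE2 → ℝ≥0∞} {a : Coset → ℝ≥0∞} (hf : Measurable f)
    (ha : Measurable a) :
    ∫⁻ g, f g * a (toCoset g) ∂haar = ∫⁻ x, periodization f x * a x ∂cosetMeasure := by
  rw [← periodization_mul_comp]
  exact (lintegral_cosetMeasure (hf.mul (ha.comp measurable_toCoset))).symm

/-- Weil's formula for the product of the constant `1` and the indicator of a null set `s`: the
periodization of `1` may be infinite, but it is multiplied by a function that vanishes almost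
everywhere. -/
theorem quasiMeasurePreserving_toCoset :
    Measure.QuasiMeasurePreserving toCoset haar cosetMeasure := by
  refine ⟨measurable_toCoset, Measure.AbsolutelyContinuous.mk fun s hs h => ?_⟩
  have := lintegral_mul_comp_toCoset (f := fun _ => 1) (a := s.indicator 1) measurable_const
    (measurable_one.indicator hs)
  have h0 : ∫⁻ x, periodization (fun _ => (1 : ℝ≥0∞)) x * s.indicator 1 x ∂cosetMeasure = 0 := by
    refine lintegral_eq_zero_of_ae_eq_zero ?_
    filter_upwards [measure_eq_zero_iff_ae_notMem.1 h] with x hx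
    simp [hx]
  rw [Measure.map_apply measurable_toCoset hs, ← lintegral_indicator_one (measurable_toCoset hs)]
  simp only [one_mul] at this
  exact this.trans h0

/-- The measure on the coset space is invariant under right translations. -/
theorem setLIntegral_domain_mul_right {A : SE2 → ℝ≥0∞}
    (hA : ∀ (γ : lattice) g, A ((γ : SE2) * g) = A g) (k : SE2) :
    ∫⁻ g in domain, A (g * k) ∂haar = ∫⁻ g in domain, A g ∂haar := by
  -- Right translation commutes with the left action of the lattice, so it carries fundamental
  -- domains to fundamental domains; an invariant function has the same integral over each.
  have hD : IsFundamentalDomain lattice ((fun g => g * k⁻¹) ⁻¹' domain) haar :=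
    isFundamentalDomain_domain.preimage_of_equiv
      (measurePreserving_mul_right_haar k⁻¹).quasiMeasurePreserving
      (e := id) Function.bijective_id fun γ g => by simp [Subgroup.smul_def, mul_assoc]
  have hpre : (fun g => g * k) ⁻¹' ((fun g => g * k⁻¹) ⁻¹' domain) = domain := by
    ext g; simp
  rw [isFundamentalDomain_domain.setLIntegral_eq hD A fun γ g => hA γ g,
    ← (measurePreserving_mul_right_haar k).setLIntegral_comp_preimage_emb
      (measurableEmbedding_mulRight k) A ((fun g => g * k⁻¹) ⁻¹' domain), hpre]

end SE2

end

/-! ### Young's inequality on the coset space; periodized convolutions -/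

noncomputable section

/-- Cauchy–Schwarz for the measure with density `b`, by splitting `b` into two square roots. -/
theorem lintegral_mul_sq_le {α : Type*} [MeasurableSpace α] (μ : Measure α) {u b : α → ℝ≥0∞}
    (hu : Measurable u) (hb : Measurable b) :
    (∫⁻ x, u x * b x ∂μ) ^ 2 ≤ (∫⁻ x, b x ∂μ) * ∫⁻ x, u x ^ 2 * b x ∂μ := by
  have hsqrt : ∀ z : ℝ≥0∞, (z ^ (1 / 2 : ℝ)) ^ (2 : ℝ) = z := fun z => by
    rw [← ENNReal.rpow_mul]; norm_num
  have hmul : ∀ z : ℝ≥0∞, z ^ (1 / 2 : ℝ) * z ^ (1 / 2 : ℝ) = z := fun z => by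
    rw [← ENNReal.rpow_add_of_nonneg _ _ (by norm_num) (by norm_num)]; norm_num
  have h := ENNReal.lintegral_mul_le_Lp_mul_Lq μ (p := 2) (q := 2)
    ⟨by norm_num, by norm_num, by norm_num⟩
    (f := fun x => b x ^ (1 / 2 : ℝ)) (g := fun x => u x * b x ^ (1 / 2 : ℝ))
    (hb.pow_const _).aemeasurable (hu.mul (hb.pow_const _)).aemeasurable
  have e₁ : ∀ x, ((fun x => b x ^ (1 / 2 : ℝ)) * fun x => u x * b x ^ (1 / 2 : ℝ)) x
      = u x * b x := fun x => by
    change b x ^ (1 / 2 : ℝ) * (u x * b x ^ (1 / 2 : ℝ)) = _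
    rw [mul_left_comm, hmul]
  have e₂ : ∀ x, (u x * b x ^ (1 / 2 : ℝ)) ^ (2 : ℝ) = u x ^ 2 * b x := fun x => by
    rw [ENNReal.mul_rpow_of_nonneg _ _ (by norm_num), hsqrt, ENNReal.rpow_two]
  simp only [e₁, e₂, hsqrt] at h
  calc (∫⁻ x, u x * b x ∂μ) ^ 2
      ≤ ((∫⁻ x, b x ∂μ) ^ (1 / 2 : ℝ) * (∫⁻ x, u x ^ 2 * b x ∂μ) ^ (1 / 2 : ℝ)) ^ 2 := by
        gcongr
    _ = _ := by
        rw [mul_pow, ← ENNReal.rpow_two, ← ENNReal.rpow_two, hsqrt, hsqrt]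

theorem eLpNorm_two_sq {α ε : Type*} [MeasurableSpace α] [ENorm ε] (μ : Measure α) (f : α → ε) :
    eLpNorm f 2 μ ^ 2 = ∫⁻ x, ‖f x‖ₑ ^ 2 ∂μ := by
  have h := eLpNorm_nnreal_pow_eq_lintegral (f := f) (μ := μ) (p := 2) two_ne_zero
  norm_num at h
  exact h

namespace SE2

/-- `(a ⊘ b)(Γ g) = ∫ a(Γ h) b(h⁻¹ g) dh` for functions with values in `[0,∞]`. -/
def cosetLConv (a : Coset → ℝ≥0∞) (b : SE2 → ℝ≥0∞) : Coset → ℝ≥0∞ :=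
  Quotient.lift (fun g => ∫⁻ h, a (toCoset h) * b (h⁻¹ * g) ∂haar) (by
    rintro g g' ⟨δ, rfl⟩
    refine (lintegral_mul_left_eq_self _ (δ : SE2)).symm.trans (lintegral_congr fun h => ?_)
    simp [toCoset_mul, mul_assoc, Subgroup.smul_def])

section

variable {a : Coset → ℝ≥0∞} {b : SE2 → ℝ≥0∞}

theorem cosetLConv_toCoset (a : Coset → ℝ≥0∞) (b : SE2 → ℝ≥0∞) (g : SE2) :
    cosetLConv a b (toCoset g) = ∫⁻ h, a (toCoset h) * b (h⁻¹ * g) ∂haar := rfl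

/-- The substitution `h = g k⁻¹` moves `g` into the argument of `a`, where right invariance of the
coset measure can act. -/
theorem cosetLConv_toCoset' (a : Coset → ℝ≥0∞) (b : SE2 → ℝ≥0∞) (g : SE2) :
    cosetLConv a b (toCoset g) = ∫⁻ k, a (toCoset (g * k⁻¹)) * b k ∂haar := by
  rw [cosetLConv_toCoset, ← lintegral_div_left_eq_self
    (μ := haar) (fun h => a (toCoset h) * b (h⁻¹ * g)) g]
  simp [div_eq_mul_inv]

theorem measurable_cosetLConv (ha : Measurable a) (hb : Measurable b) :
    Measurable (cosetLConv a b) := by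
  refine measurable_from_quotient.2 ?_
  have : Measurable fun q : SE2 × SE2 => a (toCoset q.2) * b (q.2⁻¹ * q.1) :=
    (ha.comp (measurable_toCoset.comp measurable_snd)).mul
      (hb.comp (measurable_snd.inv.mul measurable_fst))
  exact this.lintegral_prod_right'

theorem lintegral_cosetMeasure_eq {f : Coset → ℝ≥0∞} (hf : Measurable f) :
    ∫⁻ x, f x ∂cosetMeasure = ∫⁻ g in domain, f (toCoset g) ∂haar :=
  lintegral_map hf measurable_toCoset

/-- Cauchy–Schwarz with weight `b`, then Tonelli; the integral of each right translate of `a ^ 2`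
over the domain does not depend on the translation. -/
theorem lintegral_cosetLConv_sq_le (ha : Measurable a) (hb : Measurable b) :
    ∫⁻ x, cosetLConv a b x ^ 2 ∂cosetMeasure
      ≤ (∫⁻ k, b k ∂haar) ^ 2 * ∫⁻ x, a x ^ 2 ∂cosetMeasure := by
  have hm : Measurable fun q : SE2 × SE2 => a (toCoset (q.1 * q.2⁻¹)) ^ 2 * b q.2 :=
    ((ha.comp (measurable_toCoset.comp (measurable_fst.mul measurable_snd.inv))).pow_const 2).mul
      (hb.comp measurable_snd)
  calc ∫⁻ x, cosetLConv a b x ^ 2 ∂cosetMeasure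
      = ∫⁻ g in domain, (∫⁻ k, a (toCoset (g * k⁻¹)) * b k ∂haar) ^ 2 ∂haar := by
        rw [lintegral_cosetMeasure_eq ((measurable_cosetLConv ha hb).pow_const 2)]
        simp only [cosetLConv_toCoset']
    _ ≤ ∫⁻ g in domain, (∫⁻ k, b k ∂haar) *
          ∫⁻ k, a (toCoset (g * k⁻¹)) ^ 2 * b k ∂haar ∂haar :=
        lintegral_mono fun g => lintegral_mul_sq_le haar
          (ha.comp (measurable_toCoset.comp (measurable_const.mul measurable_inv))) hb
    _ = (∫⁻ k, b k ∂haar) * ∫⁻ k, (∫⁻ g in domain, a (toCoset (g * k⁻¹)) ^ 2 ∂haar) * b k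
          ∂haar := by
        rw [lintegral_const_mul _ hm.lintegral_prod_right', lintegral_lintegral_swap
          hm.aemeasurable]
        congr 1
        refine lintegral_congr fun k =>
          lintegral_mul_const (b k) (f := fun g => a (toCoset (g * k⁻¹)) ^ 2) ?_
        exact (ha.comp (measurable_toCoset.comp (measurable_mul_const _))).pow_const 2
    _ = (∫⁻ k, b k ∂haar) * ∫⁻ k, (∫⁻ x, a x ^ 2 ∂cosetMeasure) * b k ∂haar := by
        congr 1
        refine lintegral_congr fun k => ?_
        rw [lintegral_cosetMeasure_eq (ha.pow_const 2), setLIntegral_domain_mul_right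
          (A := fun g => a (toCoset g) ^ 2) (fun γ g => by rw [toCoset_mul]) k⁻¹]
    _ = _ := by rw [lintegral_const_mul _ hb]; ring

theorem eLpNorm_cosetLConv_le (ha : Measurable a) (hb : Measurable b) :
    eLpNorm (cosetLConv a b) 2 cosetMeasure
      ≤ eLpNorm a 2 cosetMeasure * ∫⁻ k, b k ∂haar := by
  rw [← ENNReal.pow_le_pow_left_iff two_ne_zero, mul_pow, eLpNorm_two_sq, eLpNorm_two_sq]
  simp only [enorm_eq_self]
  exact (lintegral_cosetLConv_sq_le ha hb).trans_eq (mul_comm _ _)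

theorem ae_cosetLConv_lt_top (ha : Measurable a) (hb : Measurable b)
    (ha' : eLpNorm a 2 cosetMeasure ≠ ∞) (hb' : ∫⁻ k, b k ∂haar ≠ ∞) :
    ∀ᵐ x ∂cosetMeasure, cosetLConv a b x < ∞ := by
  have h : ∫⁻ x, cosetLConv a b x ^ 2 ∂cosetMeasure ≠ ∞ := by
    have := (eLpNorm_cosetLConv_le ha hb).trans_lt (ENNReal.mul_lt_top ha'.lt_top hb'.lt_top)
    have h2 := ENNReal.pow_lt_top (n := 2) this
    rw [eLpNorm_two_sq] at h2
    simpa using h2.ne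
  filter_upwards [ae_lt_top ((measurable_cosetLConv ha hb).pow_const 2) h] with x hx
  by_contra hx'
  simp [not_lt_top_iff.1 hx'] at hx

end

/-! ### Periodization of convolutions -/

variable {f₁ f₂ : SE2 → ℂ}

theorem absPeriodization_toCoset (f : SE2 → ℂ) (g : SE2) :
    absPeriodization f (toCoset g) = ∑' γ : lattice, ‖f ((γ : SE2) * g)‖ₑ := rfl

theorem periodization_toCoset (f : SE2 → ℂ) (g : SE2) :
    periodization f (toCoset g) = ∑' γ : lattice, f ((γ : SE2) * g) := rfl

theorem measurable_absPeriodization (hf : Measurable f₁) : Measurable (absPeriodization f₁) :=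
  measurable_periodization hf.enorm

/-- After `h ↦ γ h` the factor `f₂` no longer depends on `γ`, and the sum falls on `f₁` alone. -/
theorem tsum_lintegral_enorm_conv (hf₁ : Measurable f₁) (hf₂ : Measurable f₂) (g : SE2) :
    ∑' γ : lattice, ∫⁻ h, ‖f₁ h‖ₑ * ‖f₂ (h⁻¹ * ((γ : SE2) * g))‖ₑ ∂haar
      = cosetLConv (absPeriodization f₁) (fun k => ‖f₂ k‖ₑ) (toCoset g) := by
  have h : ∀ γ : lattice, ∫⁻ h, ‖f₁ h‖ₑ * ‖f₂ (h⁻¹ * ((γ : SE2) * g))‖ₑ ∂haar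
      = ∫⁻ h, ‖f₁ ((γ : SE2) * h)‖ₑ * ‖f₂ (h⁻¹ * g)‖ₑ ∂haar := fun γ => by
    rw [← lintegral_mul_left_eq_self _ (γ : SE2)]
    simp [mul_assoc]
  simp_rw [h]
  rw [cosetLConv_toCoset, ← lintegral_tsum]
  · simp_rw [absPeriodization_toCoset, ENNReal.tsum_mul_right]
  · exact fun γ => ((hf₁.comp (measurable_const_mul _)).enorm.mul
      (hf₂.comp (measurable_inv.mul_const g)).enorm).aemeasurable

theorem measurable_conv (hf₁ : Measurable f₁) (hf₂ : Measurable f₂) : Measurable (conv f₁ f₂) := by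
  have : StronglyMeasurable fun q : SE2 × SE2 => f₁ q.2 * f₂ (q.2⁻¹ * q.1) :=
    ((hf₁.comp measurable_snd).mul
      (hf₂.comp (measurable_snd.inv.mul measurable_fst))).stronglyMeasurable
  exact this.integral_prod_right'.measurable

theorem absPeriodization_conv_le (hf₁ : Measurable f₁) (hf₂ : Measurable f₂) (x : Coset) :
    absPeriodization (conv f₁ f₂) x
      ≤ cosetLConv (absPeriodization f₁) (fun k => ‖f₂ k‖ₑ) x := by
  induction x using Quotient.inductionOn with | h g => ?_
  change absPeriodization _ (toCoset g) ≤ cosetLConv _ _ (toCoset g)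
  rw [← tsum_lintegral_enorm_conv hf₁ hf₂, absPeriodization_toCoset]
  refine ENNReal.tsum_le_tsum fun γ => (enorm_integral_le_lintegral_enorm _).trans_eq ?_
  simp_rw [enorm_mul]

theorem integrable_conv_of_measurable (hf₁ : Measurable f₁) (hf₂ : Measurable f₂)
    (hi₁ : Integrable f₁ haar) (hi₂ : Integrable f₂ haar) :
    Integrable (fun q : SE2 × SE2 => f₁ q.1 * f₂ (q.1⁻¹ * q.2)) (haar.prod haar) := by
  have hm : Measurable fun q : SE2 × SE2 => f₁ q.1 * f₂ (q.1⁻¹ * q.2) :=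
    (hf₁.comp measurable_fst).mul (hf₂.comp (measurable_fst.inv.mul measurable_snd))
  refine ⟨hm.aestronglyMeasurable, ?_⟩
  rw [HasFiniteIntegral, lintegral_prod _ hm.enorm.aemeasurable]
  calc ∫⁻ g, ∫⁻ h, ‖f₁ g * f₂ (g⁻¹ * h)‖ₑ ∂haar ∂haar
      = ∫⁻ g, ‖f₁ g‖ₑ * ∫⁻ h, ‖f₂ h‖ₑ ∂haar ∂haar := by
        refine lintegral_congr fun g => ?_
        simp_rw [enorm_mul]
        rw [lintegral_const_mul ‖f₁ g‖ₑ (f := fun h => ‖f₂ (g⁻¹ * h)‖ₑ)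
            (hf₂.comp (measurable_const_mul _)).enorm,
          lintegral_mul_left_eq_self (fun h => ‖f₂ h‖ₑ) g⁻¹]
    _ = (∫⁻ g, ‖f₁ g‖ₑ ∂haar) * ∫⁻ h, ‖f₂ h‖ₑ ∂haar := lintegral_mul_const _ hf₁.enorm
    _ < ∞ := ENNReal.mul_lt_top hi₁.2 hi₂.2

theorem integrable_conv (hf₁ : Measurable f₁) (hf₂ : Measurable f₂)
    (hi₁ : Integrable f₁ haar) (hi₂ : Integrable f₂ haar) : Integrable (conv f₁ f₂) haar :=
  (integrable_conv_of_measurable hf₁ hf₂ hi₁ hi₂).integral_prod_right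

theorem ae_integrable_conv (hf₁ : Measurable f₁) (hf₂ : Measurable f₂)
    (hi₁ : Integrable f₁ haar) (hi₂ : Integrable f₂ haar) :
    ∀ᵐ h ∂haar, Integrable (fun g => f₁ g * f₂ (g⁻¹ * h)) haar :=
  (integrable_conv_of_measurable hf₁ hf₂ hi₁ hi₂).prod_left_ae

theorem enorm_periodization_le (f : SE2 → ℂ) (x : Coset) :
    ‖periodization f x‖ₑ ≤ absPeriodization f x := by
  induction x using Quotient.inductionOn with | h g => exact enorm_tsum_le_tsum_enorm

theorem ae_absPeriodization_lt_top (hf : Measurable f₁) (hi : Integrable f₁ haar) :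
    ∀ᵐ x ∂cosetMeasure, absPeriodization f₁ x < ∞ := by
  refine ae_lt_top (measurable_absPeriodization hf) ?_
  rw [absPeriodization, lintegral_cosetMeasure hf.enorm]
  exact hi.2.ne

theorem summable_of_absPeriodization_lt_top {g : SE2}
    (h : absPeriodization f₁ (toCoset g) < ∞) :
    Summable fun γ : lattice => f₁ ((γ : SE2) * g) := by
  rw [absPeriodization_toCoset] at h
  refine Summable.of_norm ?_
  have := ENNReal.summable_toReal h.ne
  simpa using this

/-- Finite partial sums converge only where the series does, so the limit is taken on the invariant
set `A` of absolute convergence, which has full measure. -/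
theorem aestronglyMeasurable_periodization (hf : Measurable f₁) (hi : Integrable f₁ haar) :
    AEStronglyMeasurable (periodization f₁) cosetMeasure := by
  let A : Set Coset := {x | absPeriodization f₁ x < ∞}
  have hA : MeasurableSet A := measurableSet_lt (measurable_absPeriodization hf) measurable_const
  have hm : Measurable (A.indicator (periodization f₁)) := by
    refine measurable_from_quotient.2 ?_
    refine measurable_of_tendsto_metrizable' (atTop : Filter (Finset lattice))
      (f := fun (s : Finset lattice) =>
        (toCoset ⁻¹' A).indicator fun g => ∑ γ ∈ s, f₁ ((γ : SE2) * g))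
      (fun s => (Finset.measurable_fun_sum s fun γ _ =>
        hf.comp (measurable_const_mul (γ : SE2))).indicator (measurable_toCoset hA)) ?_
    refine tendsto_pi_nhds.2 fun g => ?_
    by_cases hg : toCoset g ∈ A
    · have h₁ : g ∈ toCoset ⁻¹' A := hg
      simp only [Set.indicator_of_mem h₁]
      change Tendsto _ _ (𝓝 (A.indicator (periodization f₁) (toCoset g)))
      rw [Set.indicator_of_mem hg]
      exact (summable_of_absPeriodization_lt_top hg).hasSum
    · have h₁ : g ∉ toCoset ⁻¹' A := hg
      simp only [Set.indicator_of_notMem h₁]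
      change Tendsto _ _ (𝓝 (A.indicator (periodization f₁) (toCoset g)))
      rw [Set.indicator_of_notMem hg]
      exact tendsto_const_nhds
  refine hm.aestronglyMeasurable.congr ?_
  filter_upwards [ae_absPeriodization_lt_top hf hi] with x hx
  exact Set.indicator_of_mem (s := A) hx _

theorem cosetConv_toCoset (ψ : Coset → ℂ) (f : SE2 → ℂ) (g : SE2) :
    cosetConv ψ f (toCoset g) = ∫ h, ψ (toCoset h) * f (h⁻¹ * g) ∂haar := rfl

theorem integrable_cosetConv (hf₁ : Measurable f₁) (hf₂ : Measurable f₂)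
    (hi₁ : Integrable f₁ haar) {g : SE2}
    (hg : cosetLConv (absPeriodization f₁) (fun k => ‖f₂ k‖ₑ) (toCoset g) < ∞) :
    Integrable (fun h => periodization f₁ (toCoset h) * f₂ (h⁻¹ * g)) haar := by
  refine ⟨((aestronglyMeasurable_periodization hf₁ hi₁).comp_quasiMeasurePreserving
    quasiMeasurePreserving_toCoset).mul
    (hf₂.comp (measurable_inv.mul_const g)).aestronglyMeasurable, lt_of_le_of_lt ?_ hg⟩
  rw [cosetLConv_toCoset]
  refine lintegral_mono fun h => ?_
  rw [enorm_mul]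
  gcongr
  exact enorm_periodization_le _ _

/-- The shift of `tsum_lintegral_enorm_conv`, now for complex values; the finiteness of that sum,
which is `hx`, permits exchanging sum and integral. -/
theorem cosetConv_eq_periodization_conv (hf₁ : Measurable f₁) (hf₂ : Measurable f₂) {x : Coset}
    (hx : cosetLConv (absPeriodization f₁) (fun k => ‖f₂ k‖ₑ) x < ∞) :
    cosetConv (periodization f₁) f₂ x = periodization (conv f₁ f₂) x := by
  induction x using Quotient.inductionOn with | h g => ?_
  change cosetConv _ _ (toCoset g) = periodization _ (toCoset g)
  change cosetLConv _ _ (toCoset g) < ∞ at hx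
  have hshift : ∀ γ : lattice, conv f₁ f₂ ((γ : SE2) * g)
      = ∫ h, f₁ ((γ : SE2) * h) * f₂ (h⁻¹ * g) ∂haar := fun γ => by
    rw [conv, ← integral_mul_left_eq_self _ (γ : SE2)]
    simp [mul_assoc]
  simp_rw [cosetConv_toCoset, periodization_toCoset, hshift, ← tsum_mul_right]
  refine integral_tsum (fun γ => ((hf₁.comp (measurable_const_mul _)).mul
    (hf₂.comp (measurable_inv.mul_const g))).aestronglyMeasurable) (ne_of_lt ?_)
  refine lt_of_eq_of_lt ?_ hx
  rw [← tsum_lintegral_enorm_conv hf₁ hf₂]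
  refine tsum_congr fun γ => ?_
  rw [← lintegral_mul_left_eq_self (fun h => ‖f₁ h‖ₑ * ‖f₂ (h⁻¹ * ((γ : SE2) * g))‖ₑ) (γ : SE2)]
  simp [mul_assoc]

end SE2

end

/-! ### Matrix elements and the convolution theorem -/

noncomputable section

theorem hasSum_integral_of_tsum_lintegral {α ι : Type*} [MeasurableSpace α] [Countable ι]
    {μ : Measure α} {F : ι → α → ℂ} {f : α → ℂ} (hF : ∀ i, AEStronglyMeasurable (F i) μ)
    (hsum : ∑' i, ∫⁻ x, ‖F i x‖ₑ ∂μ ≠ ∞) (hf : ∀ᵐ x ∂μ, HasSum (fun i => F i x) (f x)) :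
    HasSum (fun i => ∫ x, F i x ∂μ) (∫ x, f x ∂μ) := by
  have hint : ∀ i, Integrable (F i) μ := fun i =>
    ⟨hF i, (ENNReal.ne_top_of_tsum_ne_top hsum i).lt_top⟩
  have h := hasSum_integral_of_summable_integral_norm hint (by
    simp_rw [integral_norm_eq_lintegral_enorm (hF _)]
    exact ENNReal.summable_toReal hsum)
  rwa [integral_congr_ae (hf.mono fun x hx => hx.tsum_eq)] at h

/-- With `b = a + c` the gap is `c ^ 2`, so no subtraction is needed. It stands in for
Cauchy–Schwarz where only finiteness, or a bound for unit vectors, matters. -/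
theorem ENNReal.mul_le_half_sq_add_sq (a b : ℝ≥0∞) : 2 * (a * b) ≤ a ^ 2 + b ^ 2 := by
  wlog h : a ≤ b generalizing a b
  · rw [mul_comm a b, add_comm]
    exact this b a (le_of_not_ge h)
  obtain ⟨c, rfl⟩ := exists_add_of_le h
  calc 2 * (a * (a + c)) ≤ 2 * (a * (a + c)) + c ^ 2 := le_self_add
    _ = a ^ 2 + (a + c) ^ 2 := by ring

namespace SE2

open Circle

/-! ### The representation -/

theorem inner_circle_mul (R u : Circle) (x : ℂ) :
    (inner ℝ ((R * u : Circle) : ℂ) x : ℝ) = inner ℝ (u : ℂ) (((R⁻¹ : Circle) : ℂ) * x) := by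
  have h := (rotation R⁻¹).inner_map_map ((R * u : Circle) : ℂ) x
  rw [rotation_apply, rotation_apply, ← Circle.coe_mul, inv_mul_cancel_left] at h
  exact h.symm

theorem rep_mul (p : ℝ) (g h : SE2) (φ : Circle → ℂ) :
    rep p (g * h) φ = rep p g (rep p h φ) := by
  funext u
  simp only [rep, trans_mul, rot_mul, mul_inv_rev, mul_assoc, inner_circle_mul, inv_inv]
  rw [← mul_assoc (Complex.exp _) (Complex.exp _), ← Complex.exp_add, inner_add_right]
  push_cast
  ring_nf

theorem rep_one (p : ℝ) (φ : Circle → ℂ) : rep p 1 φ = φ := by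
  funext u; simp [rep]

theorem norm_rep (p : ℝ) (g : SE2) (φ : Circle → ℂ) (u : Circle) :
    ‖rep p g φ u‖ = ‖φ ((g.rot)⁻¹ * u)‖ := by
  have : -Complex.I * p * (inner ℝ (u : ℂ) g.trans : ℝ)
      = ((-p * inner ℝ (u : ℂ) g.trans : ℝ) : ℂ) * Complex.I := by push_cast; ring
  rw [rep, norm_mul, this, Complex.norm_exp_ofReal_mul_I, one_mul]

theorem norm_fourierBasis (k : ℤ) (u : Circle) : ‖fourierBasis k u‖ = 1 := by
  rw [fourierBasis, norm_zpow, Circle.norm_coe, one_zpow]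

theorem norm_rep_fourierBasis (p : ℝ) (g : SE2) (k : ℤ) (u : Circle) :
    ‖rep p g (fourierBasis k) u‖ = 1 := by
  rw [norm_rep, norm_fourierBasis]

theorem continuous_rep_uncurry (k : ℤ) :
    Continuous fun q : (ℝ × SE2) × Circle => rep q.1.1 q.1.2 (fourierBasis k) q.2 := by
  have h₁ : Continuous fun q : (ℝ × SE2) × Circle => (inner ℝ (q.2 : ℂ) q.1.2.trans : ℝ) :=
    (continuous_coe_circle.comp continuous_snd).inner
      (continuous_trans.comp (continuous_snd.comp continuous_fst))
  have h₂ : Continuous fun q : (ℝ × SE2) × Circle => (q.1.2.rot)⁻¹ * q.2 :=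
    (continuous_rot.comp (continuous_snd.comp continuous_fst)).inv.mul continuous_snd
  exact (Complex.continuous_exp.comp ((continuous_const.mul (Complex.continuous_ofReal.comp
    (continuous_fst.comp continuous_fst))).mul (Complex.continuous_ofReal.comp h₁))).mul
    ((continuous_fourierBasis k).comp h₂)

theorem continuous_rep (p : ℝ) (g : SE2) (k : ℤ) : Continuous (rep p g (fourierBasis k)) :=
  (continuous_rep_uncurry k).comp (Continuous.prodMk_right (p, g))

theorem circleInner_conj (φ χ : Circle → ℂ) :
    starRingEnd ℂ (circleInner φ χ) = circleInner χ φ := by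
  simp_rw [circleInner_eq]
  rw [← integral_conj]
  simp [mul_comm]

/-- Unitarity: the phase cancels against its conjugate and the invariant measure absorbs the
rotation. No regularity of `φ` and `χ` is needed. -/
theorem circleInner_rep (p : ℝ) (g : SE2) (φ χ : Circle → ℂ) :
    circleInner (rep p g φ) (rep p g χ) = circleInner φ χ := by
  simp_rw [circleInner_eq]
  rw [← integral_mul_left_eq_self (fun u => φ u * starRingEnd ℂ (χ u)) (g.rot)⁻¹]
  refine integral_congr_ae (Eventually.of_forall fun u => ?_)
  have he : ∀ t : ℝ, Complex.exp (-Complex.I * p * t) *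
      starRingEnd ℂ (Complex.exp (-Complex.I * p * t)) = 1 := fun t => by
    rw [← Complex.exp_conj, ← Complex.exp_add]
    simp
  simp only [rep, map_mul]
  rw [mul_mul_mul_comm, he, one_mul]

theorem circleInner_rep_left (p : ℝ) (g : SE2) (φ χ : Circle → ℂ) :
    circleInner (rep p g φ) χ = circleInner φ (rep p g⁻¹ χ) := by
  rw [← circleInner_rep p g φ, ← rep_mul, mul_inv_cancel, rep_one]

theorem repEntry_inv (p : ℝ) (m n : ℤ) (g : SE2) :
    repEntry p n m g⁻¹ = starRingEnd ℂ (repEntry p m n g) := by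
  rw [repEntry, repEntry, circleInner_conj, circleInner_rep_left, inv_inv]

/-- Parseval for `U_p(g) e_n`, which has modulus one everywhere. -/
theorem tsum_enorm_repEntry_sq (p : ℝ) (n : ℤ) (g : SE2) :
    ∑' k : ℤ, ‖repEntry p n k g‖ₑ ^ 2 = 1 := by
  have h : ∀ u, ‖rep p g (fourierBasis n) u‖ₑ = 1 := fun u => by
    rw [← ofReal_norm, norm_rep_fourierBasis, ENNReal.ofReal_one]
  simp_rw [repEntry, tsum_enorm_circleInner_sq (memLp_of_continuous (continuous_rep p g n)), h]
  simp

theorem tsum_enorm_repEntry_sq' (p : ℝ) (m : ℤ) (g : SE2) :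
    ∑' k : ℤ, ‖repEntry p k m g‖ₑ ^ 2 = 1 := by
  rw [← tsum_enorm_repEntry_sq p m g⁻¹]
  refine tsum_congr fun k => ?_
  rw [repEntry_inv, RCLike.enorm_conj]

theorem enorm_repEntry_le (p : ℝ) (n m : ℤ) (g : SE2) : ‖repEntry p n m g‖ₑ ≤ 1 := by
  rw [← ENNReal.pow_le_pow_left_iff two_ne_zero, one_pow, ← tsum_enorm_repEntry_sq p n g]
  exact ENNReal.le_tsum (f := fun k => ‖repEntry p n k g‖ₑ ^ 2) m

theorem norm_repEntry_le (p : ℝ) (n m : ℤ) (g : SE2) : ‖repEntry p n m g‖ ≤ 1 := by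
  have h := enorm_repEntry_le p n m g
  rwa [← ofReal_norm, ENNReal.ofReal_le_one] at h

/-- The addition theorem for the matrix elements. -/
theorem hasSum_repEntry_mul (p : ℝ) (n m : ℤ) (g h : SE2) :
    HasSum (fun k => repEntry p n k h * repEntry p k m g) (repEntry p n m (g * h)) := by
  -- Parseval for `⟨U(h) e_n, U(g⁻¹) e_m⟩`, which by unitarity is `⟨U(gh) e_n, e_m⟩`.
  have H := hasSum_circleInner_mul (memLp_of_continuous (continuous_rep p h n))
    (memLp_of_continuous (continuous_rep p g⁻¹ m))
  rw [← circleInner_rep_left, ← rep_mul] at H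
  refine H.congr_fun fun k => ?_
  change _ = repEntry p n k h * starRingEnd ℂ (repEntry p m k g⁻¹)
  rw [repEntry_inv, Complex.conj_conj]

theorem stronglyMeasurable_repEntry (n m : ℤ) :
    StronglyMeasurable fun q : ℝ × SE2 => repEntry q.1 n m q.2 := by
  have hc : Continuous fun q : (ℝ × SE2) × Circle =>
      rep q.1.1 q.1.2 (fourierBasis n) q.2 * starRingEnd ℂ (fourierBasis m q.2) :=
    (continuous_rep_uncurry n).mul (Complex.continuous_conj.comp
      ((continuous_fourierBasis m).comp continuous_snd))
  have hs : StronglyMeasurable fun q : ℝ × SE2 => ∫ u,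
      rep q.1 q.2 (fourierBasis n) u * starRingEnd ℂ (fourierBasis m u) ∂probHaar :=
    hc.measurable.stronglyMeasurable.integral_prod_right'
  have he : (fun q : ℝ × SE2 => repEntry q.1 n m q.2) = fun q : ℝ × SE2 => ∫ u,
      rep q.1 q.2 (fourierBasis n) u * starRingEnd ℂ (fourierBasis m u) ∂probHaar := by
    funext q
    rw [repEntry, circleInner_eq]
  exact he ▸ hs

theorem measurable_repEntry (p : ℝ) (n m : ℤ) : Measurable fun g => repEntry p n m g := by
  have h : Measurable fun g : SE2 => (p, g) := measurable_const.prodMk measurable_id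
  have h' := Measurable.comp (stronglyMeasurable_repEntry n m).measurable h
  exact h'

/-! ### Matrix elements of the Fourier transform -/

variable {f f₁ f₂ : SE2 → ℂ}

/-- Fubini: the kernel has modulus one and the circle has finite measure, so `|f|` dominates. -/
theorem fourierEntry_eq (hf : Integrable f haar) (p : ℝ) (n m : ℤ) :
    fourierEntry f p n m = ∫ g, f g * repEntry p n m g⁻¹ ∂haar := by
  have hc : Continuous fun q : Circle × SE2 =>
      rep p q.2⁻¹ (fourierBasis n) q.1 * starRingEnd ℂ (fourierBasis m q.1) :=
    ((continuous_rep_uncurry n).comp ((continuous_const.prodMk continuous_snd.inv).prodMk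
      continuous_fst)).mul (Complex.continuous_conj.comp
        ((continuous_fourierBasis m).comp continuous_fst))
  have hint : Integrable (fun q : Circle × SE2 => f q.2 *
      (rep p q.2⁻¹ (fourierBasis n) q.1 * starRingEnd ℂ (fourierBasis m q.1)))
      (probHaar.prod haar) := by
    refine (hf.comp_snd probHaar).mul_bdd (c := 1) hc.aestronglyMeasurable
      (Eventually.of_forall fun q => ?_)
    rw [norm_mul, norm_rep_fourierBasis, RCLike.norm_conj, norm_fourierBasis, one_mul]
  have h₁ : fourierEntry f p n m = ∫ u, ∫ g, f g *
      (rep p g⁻¹ (fourierBasis n) u * starRingEnd ℂ (fourierBasis m u)) ∂haar ∂probHaar := by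
    rw [fourierEntry, circleInner_eq]
    refine integral_congr_ae (Eventually.of_forall fun u => ?_)
    simp_rw [← mul_assoc]
    exact (integral_mul_const _ _).symm
  rw [h₁, integral_integral_swap hint]
  refine integral_congr_ae (Eventually.of_forall fun g => ?_)
  have h₂ : repEntry p n m g⁻¹ = ∫ u, rep p g⁻¹ (fourierBasis n) u *
      starRingEnd ℂ (fourierBasis m u) ∂probHaar := by rw [repEntry, circleInner_eq]
  exact (integral_const_mul _ _).trans (congrArg (f g * ·) h₂.symm)

theorem stronglyMeasurable_fourierEntry (hf : Integrable f haar) (n m : ℤ) :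
    StronglyMeasurable fun p : ℝ => fourierEntry f p n m := by
  have hinv : Measurable fun q : ℝ × SE2 => (q.1, q.2⁻¹) :=
    measurable_fst.prodMk measurable_snd.inv
  have hT := (stronglyMeasurable_repEntry n m).comp_measurable hinv
  have hF : StronglyMeasurable fun q : ℝ × SE2 => hf.1.mk f q.2 :=
    hf.1.stronglyMeasurable_mk.comp_measurable measurable_snd
  have hs := (hF.mul hT).integral_prod_right' (ν := haar)
  have h : (fun p => fourierEntry f p n m)
      = fun p => ∫ g, hf.1.mk f g * repEntry p n m g⁻¹ ∂haar := by
    funext p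
    rw [fourierEntry_eq hf]
    exact integral_congr_ae (by filter_upwards [hf.1.ae_eq_mk] with g hg using by rw [← hg])
  exact h ▸ hs

/-- Cauchy–Schwarz with weight `|f|`, then the unit `ℓ²` norm in the first index of a unitary
matrix. The bound is uniform in `p`, so `f₂` will only have to be integrable. -/
theorem tsum_enorm_fourierEntry_sq_le (hf : Measurable f) (hi : Integrable f haar) (p : ℝ)
    (m : ℤ) :
    ∑' k : ℤ, ‖fourierEntry f p k m‖ₑ ^ 2 ≤ (∫⁻ g, ‖f g‖ₑ ∂haar) ^ 2 := by
  have hm : ∀ k, Measurable fun g : SE2 => ‖repEntry p k m g⁻¹‖ₑ := fun k =>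
    ((measurable_repEntry p k m).comp measurable_inv).enorm
  calc ∑' k : ℤ, ‖fourierEntry f p k m‖ₑ ^ 2
      ≤ ∑' k : ℤ, (∫⁻ g, ‖f g‖ₑ ∂haar) * ∫⁻ g, ‖repEntry p k m g⁻¹‖ₑ ^ 2 * ‖f g‖ₑ ∂haar := by
        refine ENNReal.tsum_le_tsum fun k => le_trans ?_ (lintegral_mul_sq_le haar (hm k) hf.enorm)
        gcongr
        rw [fourierEntry_eq hi]
        refine (enorm_integral_le_lintegral_enorm _).trans_eq ?_
        simp_rw [enorm_mul, mul_comm]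
    _ = (∫⁻ g, ‖f g‖ₑ ∂haar) * ∫⁻ g, (∑' k : ℤ, ‖repEntry p k m g⁻¹‖ₑ ^ 2) * ‖f g‖ₑ ∂haar := by
        rw [ENNReal.tsum_mul_left]
        congr 1
        simp_rw [← ENNReal.tsum_mul_right]
        exact (lintegral_tsum fun k => (((hm k).pow_const 2).mul hf.enorm).aemeasurable).symm
    _ = _ := by simp_rw [tsum_enorm_repEntry_sq', one_mul, sq]

/-- The Fourier transform maps convolutions to products of matrices. -/
theorem hasSum_fourierEntry_mul (hf₁ : Measurable f₁) (hf₂ : Measurable f₂)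
    (hi₁ : Integrable f₁ haar) (hi₂ : Integrable f₂ haar) (p : ℝ) (n m : ℤ) :
    HasSum (fun k => fourierEntry f₁ p n k * fourierEntry f₂ p k m)
      (fourierEntry (conv f₁ f₂) p n m) := by
  have hm : ∀ n m, Measurable fun g : SE2 => repEntry p n m g⁻¹ := fun n m =>
    (measurable_repEntry p n m).comp measurable_inv
  have hF : ∀ k, Measurable fun q : SE2 × SE2 =>
      (f₁ q.1 * repEntry p n k q.1⁻¹) * (f₂ q.2 * repEntry p k m q.2⁻¹) := fun k =>
    ((hf₁.mul (hm n k)).comp measurable_fst).mul ((hf₂.mul (hm k m)).comp measurable_snd)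
  -- The substitution `h ↦ g h` evaluates the representation at `h⁻¹ g⁻¹`. The operators multiply as
  -- `f̂₂ f̂₁`, and the convention `f̂_{nm} = ⟨f̂ e_n, e_m⟩` restores the order for matrices.
  have hconv : fourierEntry (conv f₁ f₂) p n m
      = ∫ q : SE2 × SE2, f₁ q.1 * f₂ q.2 * repEntry p n m (q.2⁻¹ * q.1⁻¹) ∂(haar.prod haar) := by
    have hb : ∀ {F : SE2 × SE2 → ℂ} {T : SE2 × SE2 → SE2} (_ : Integrable F (haar.prod haar))
        (_ : Measurable T), Integrable (fun q => F q * repEntry p n m (T q)) (haar.prod haar) :=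
      fun hF hT => hF.mul_bdd (c := 1)
        ((measurable_repEntry p n m).comp hT).aestronglyMeasurable
        (Eventually.of_forall fun q => norm_repEntry_le p n m _)
    rw [fourierEntry_eq (integrable_conv hf₁ hf₂ hi₁ hi₂)]
    simp_rw [conv, ← integral_mul_const]
    rw [integral_integral_swap, integral_prod
      (fun q : SE2 × SE2 => f₁ q.1 * f₂ q.2 * repEntry p n m (q.2⁻¹ * q.1⁻¹))
      (hb (hi₁.mul_prod hi₂) (measurable_snd.inv.mul measurable_fst.inv))]
    · refine integral_congr_ae (Eventually.of_forall fun g => ?_)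
      change ∫ h, f₁ g * f₂ (g⁻¹ * h) * repEntry p n m h⁻¹ ∂haar = _
      rw [← integral_mul_left_eq_self _ g]
      simp
    · exact (hb (integrable_conv_of_measurable hf₁ hf₂ hi₁ hi₂) measurable_snd.inv).swap
  have hterm : ∀ k, fourierEntry f₁ p n k * fourierEntry f₂ p k m
      = ∫ q : SE2 × SE2, (f₁ q.1 * repEntry p n k q.1⁻¹) * (f₂ q.2 * repEntry p k m q.2⁻¹)
        ∂(haar.prod haar) := fun k => by
    rw [fourierEntry_eq hi₁, fourierEntry_eq hi₂, ← integral_prod_mul]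
  simp_rw [hterm]
  rw [hconv]
  refine hasSum_integral_of_tsum_lintegral (fun k => (hF k).aestronglyMeasurable) (ne_of_lt ?_)
    (Eventually.of_forall fun q => ?_)
  · rw [← lintegral_tsum fun k => (hF k).enorm.aemeasurable]
    have hle : ∀ q : SE2 × SE2, ∑' k : ℤ,
        ‖(f₁ q.1 * repEntry p n k q.1⁻¹) * (f₂ q.2 * repEntry p k m q.2⁻¹)‖ₑ
        ≤ ‖f₁ q.1 * f₂ q.2‖ₑ := fun q => by
      have h1 : ∑' k : ℤ, ‖repEntry p n k q.1⁻¹‖ₑ * ‖repEntry p k m q.2⁻¹‖ₑ ≤ 1 := by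
        -- A row and a column of unitary matrices have `ℓ²` norm one, so the right side is `1 + 1`.
        have : 2 * ∑' k : ℤ, ‖repEntry p n k q.1⁻¹‖ₑ * ‖repEntry p k m q.2⁻¹‖ₑ ≤ 2 * 1 := by
          rw [← ENNReal.tsum_mul_left]
          refine (ENNReal.tsum_le_tsum fun k => ENNReal.mul_le_half_sq_add_sq _ _).trans_eq ?_
          rw [ENNReal.tsum_add, tsum_enorm_repEntry_sq, tsum_enorm_repEntry_sq', mul_one,
            one_add_one_eq_two]
        exact (ENNReal.mul_le_mul_iff_right two_ne_zero ENNReal.ofNat_ne_top).1 this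
      calc _ = ∑' k : ℤ, ‖f₁ q.1 * f₂ q.2‖ₑ *
            (‖repEntry p n k q.1⁻¹‖ₑ * ‖repEntry p k m q.2⁻¹‖ₑ) := by
            refine tsum_congr fun k => ?_
            simp_rw [enorm_mul]; ring
        _ ≤ ‖f₁ q.1 * f₂ q.2‖ₑ * 1 := by
            rw [ENNReal.tsum_mul_left]; gcongr
        _ = _ := mul_one _
    exact (lintegral_mono hle).trans_lt (hi₁.mul_prod hi₂).2
  · refine ((hasSum_repEntry_mul p n m q.2⁻¹ q.1⁻¹).mul_left (f₁ q.1 * f₂ q.2)).congr_fun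
      fun k => ?_
    ring

/-- Since `u_{nm}(g⁻¹) = conj u_{mn}(g)`, pairing with the truncated kernel becomes a Plancherel
inner product. -/
theorem kernelOn_eq {K : Set SE2} (hK : MeasurableSet K) {ψ : Coset → ℂ}
    (hi : Integrable (K.indicator fun g => ψ (toCoset g)) haar) (p : ℝ) (m n : ℤ) :
    kernelOn K ψ p m n
      = starRingEnd ℂ (fourierEntry (K.indicator fun g => ψ (toCoset g)) p n m) := by
  rw [fourierEntry_eq hi, kernelOn, ← integral_indicator hK, ← integral_conj]
  refine integral_congr_ae (Eventually.of_forall fun g => ?_)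
  by_cases hg : g ∈ K
  · simp [hg, repEntry_inv, mul_comm]
  · simp [hg]

end SE2

end

/-! ### Plancherel's formula for rigid motions -/

noncomputable section

open FourierTransform in
-- The Jacobian `r⁻²` in real dimension two cancels the factor `r ^ 2`.
theorem lintegral_enorm_sq_dilate {r : ℝ} (hr : 0 < r) {F : ℂ → ℂ} (hF : Measurable F) :
    ∫⁻ ξ : ℂ, ‖(r : ℂ) * F (-r • ξ)‖ₑ ^ 2 = ∫⁻ ξ, ‖F ξ‖ₑ ^ 2 := by
  have h := Measure.map_addHaar_smul (volume : Measure ℂ) (neg_ne_zero.2 hr.ne')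
  have hm : Measurable fun ξ : ℂ => ‖F ξ‖ₑ ^ 2 := hF.enorm.pow_const 2
  have h1 : ∫⁻ ξ : ℂ, ‖F (-r • ξ)‖ₑ ^ 2 = ENNReal.ofReal (|((-r) ^ 2)⁻¹|) *
      ∫⁻ ξ, ‖F ξ‖ₑ ^ 2 := by
    rw [← lintegral_map hm (measurable_const_smul (-r)), h, lintegral_smul_measure,
      Complex.finrank_real_complex, smul_eq_mul]
  simp_rw [enorm_mul, mul_pow]
  rw [lintegral_const_mul _ (f := fun ξ : ℂ => ‖F (-r • ξ)‖ₑ ^ 2)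
    (hm.comp (measurable_const_smul (-r))), h1, ← mul_assoc,
    enorm_sq_eq_ofReal, ← ENNReal.ofReal_mul (sq_nonneg _), Complex.norm_real]
  have : ‖r‖ ^ 2 * |((-r) ^ 2)⁻¹| = 1 := by
    rw [Real.norm_eq_abs, sq_abs, neg_sq, abs_of_pos (by positivity)]
    field_simp
  rw [this, ENNReal.ofReal_one, one_mul]

namespace SE2

open Circle FourierTransform

theorem lintegral_polar {G : ℂ → ℝ≥0∞} (hG : Measurable G) :
    ENNReal.ofReal (2 * Real.pi) *
      ∫⁻ p in Set.Ioi (0 : ℝ), (∫⁻ u : Circle, G (p • (u : ℂ)) ∂probHaar) * ENNReal.ofReal p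
      = ∫⁻ ξ, G ξ := by
  have hpt : ∀ p α : ℝ, Complex.polarCoord.symm (p, α) = p • ((Circle.exp α : Circle) : ℂ) := by
    intro p α
    rw [Complex.polarCoord_symm_apply, Circle.coe_exp, Complex.exp_mul_I, Complex.real_smul]
    simp
  have hm : Measurable fun q : ℝ × ℝ =>
      ENNReal.ofReal q.1 • G (q.1 • ((Circle.exp q.2 : Circle) : ℂ)) := by
    refine (ENNReal.measurable_ofReal.comp measurable_fst).mul (hG.comp ?_)
    exact (continuous_fst.smul (continuous_coe_circle.comp
      (Circle.exp.continuous.comp continuous_snd))).measurable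
  have hm' : Measurable fun q : ℝ × Circle => G (q.1 • (q.2 : ℂ)) :=
    hG.comp (continuous_fst.smul (continuous_coe_circle.comp continuous_snd)).measurable
  rw [← Complex.lintegral_comp_polarCoord_symm, polarCoord_target, Measure.volume_eq_prod,
    ← Measure.prod_restrict, Measure.restrict_congr_set Ioo_ae_eq_Ioc]
  have he : ∀ q : ℝ × ℝ, Complex.polarCoord.symm q
      = q.1 • ((Circle.exp q.2 : Circle) : ℂ) := fun q => hpt q.1 q.2
  simp_rw [he]
  have hin : Measurable fun p : ℝ => ∫⁻ u : Circle, G (p • (u : ℂ)) ∂probHaar :=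
    hm'.lintegral_prod_right'
  rw [lintegral_prod _ hm.aemeasurable, ← lintegral_const_mul _
    (f := fun p => (∫⁻ u : Circle, G (p • (u : ℂ)) ∂probHaar) * ENNReal.ofReal p)
    (hin.mul ENNReal.measurable_ofReal)]
  refine lintegral_congr fun p => ?_
  -- Angles in polar coordinates start at `-π`.
  have h := lintegral_probHaar (fun u => G (p • (u : ℂ))) (-Real.pi)
  rw [show -Real.pi + 2 * Real.pi = Real.pi by ring] at h
  simp only [smul_eq_mul]
  rw [← mul_assoc, h, lintegral_const_mul, mul_comm]
  exact hG.comp ((continuous_const_smul p).comp (continuous_coe_circle.comp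
      Circle.exp.continuous)).measurable

variable {f : SE2 → ℂ}

/-- The Fourier coefficients of a function in the rotation variable. -/
def rotCoeff (f : SE2 → ℂ) (m : ℤ) (x : ℂ) : ℂ :=
  ∫ R, f (mk x R) * fourierBasis m R ∂probHaar

/-- Integrating against `e_m`, not its conjugate, gives the coefficient of index `-m`; this is the
form in which `conj (U_p(g) e_m)` produces it. -/
theorem rotCoeff_eq (f : SE2 → ℂ) (m : ℤ) (x : ℂ) :
    rotCoeff f m x = circleInner (fun R => f (mk x R)) (fourierBasis (-m)) := by
  rw [rotCoeff, circleInner_eq]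
  refine integral_congr_ae (Eventually.of_forall fun R => ?_)
  simp [fourierBasis, ← Circle.coe_inv_eq_conj]

theorem integrable_mul_fourierBasis (hi : Integrable f haar) (m : ℤ) :
    Integrable (fun q : Circle × ℂ => f (mk q.2 q.1) * fourierBasis m q.1)
      (probHaar.prod volume) :=
  (integrable_haar_iff.1 hi).mul_bdd (c := 1)
    ((continuous_fourierBasis m).comp continuous_fst).aestronglyMeasurable
    (Eventually.of_forall fun q => (norm_fourierBasis m q.1).le)

theorem integrable_rotCoeff (hi : Integrable f haar) (m : ℤ) : Integrable (rotCoeff f m) :=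
  (integrable_mul_fourierBasis hi m).integral_prod_right

/-- For `g = (x, R)` the conjugate of `(U_p(g) e_m)(u)` is `exp(ip⟨u,x⟩) e_m(R) conj e_m(u)`.
Integrating over `R` gives `rotCoeff`; over `x`, the kernel `exp(-2πi⟨x,ξ⟩)` forces `ξ = -pu/(2π)`.
The outer `1/(2π)` comes from `haar_eq`. -/
theorem integral_mul_conj_rep (hi : Integrable f haar) (p : ℝ) (m : ℤ) (u : Circle) :
    ∫ g, f g * starRingEnd ℂ (rep p g (fourierBasis m) u) ∂haar
      = starRingEnd ℂ (fourierBasis m u) * (((1 / (2 * Real.pi) : ℝ) : ℂ) *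
        𝓕 (rotCoeff f m) (-(1 / (2 * Real.pi)) • (p • (u : ℂ)))) := by
  have hpt : ∀ q : Circle × ℂ,
      f (ofPair q) * starRingEnd ℂ (rep p (ofPair q) (fourierBasis m) u)
      = starRingEnd ℂ (fourierBasis m u) *
        (Complex.exp (((-2 * Real.pi * inner ℝ q.2 (-(1 / (2 * Real.pi)) • (p • (u : ℂ))) : ℝ) : ℂ)
          * Complex.I) * (f (mk q.2 q.1) * fourierBasis m q.1)) := fun q => by
    have h₁ : starRingEnd ℂ (fourierBasis m (q.1⁻¹ * u))
        = fourierBasis m q.1 * starRingEnd ℂ (fourierBasis m u) := by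
      simp [fourierBasis, mul_zpow, ← Circle.coe_inv_eq_conj]
    have h₂ : starRingEnd ℂ (Complex.exp (-Complex.I * p * (inner ℝ (u : ℂ) q.2 : ℝ)))
        = Complex.exp (((-2 * Real.pi * inner ℝ q.2 (-(1 / (2 * Real.pi)) • (p • (u : ℂ))) : ℝ)
          : ℂ) * Complex.I) := by
      rw [← Complex.exp_conj]
      congr 1
      rw [inner_smul_right, inner_smul_right, real_inner_comm]
      have : (Real.pi : ℂ) ≠ 0 := by exact_mod_cast Real.pi_ne_zero
      simp only [map_mul, map_neg, Complex.conj_I, Complex.conj_ofReal]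
      push_cast
      field_simp
    change f (mk q.2 q.1) * starRingEnd ℂ
      (Complex.exp (-Complex.I * p * (inner ℝ (u : ℂ) q.2 : ℝ)) * fourierBasis m (q.1⁻¹ * u)) = _
    rw [map_mul, h₁, h₂]
    ring
  rw [integral_haar]
  simp_rw [hpt]
  rw [integral_const_mul, integral_prod_symm, Real.fourier_eq']
  · simp_rw [integral_const_mul, smul_eq_mul]
    change _ = _ * (_ * ∫ x, _ * ∫ R, f (mk x R) * fourierBasis m R ∂probHaar)
    push_cast
    ring
  · refine (integrable_mul_fourierBasis hi m).bdd_mul (c := 1) ?_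
      (Eventually.of_forall fun q => (Complex.norm_exp_ofReal_mul_I _).le)
    refine Continuous.aestronglyMeasurable ?_
    exact Complex.continuous_exp.comp ((Complex.continuous_ofReal.comp
      (continuous_const.mul (continuous_snd.inner continuous_const))).mul continuous_const)

/-- Unitarity moves `U_p(g⁻¹)` onto `e_m`, and Fubini does the rest. The second function does not
depend on `n`, so Parseval applies to the sum over `n`. -/
theorem fourierEntry_eq_circleInner (hi : Integrable f haar) (p : ℝ) (n m : ℤ) :
    fourierEntry f p n m = circleInner (fourierBasis n)
      (fun u => fourierBasis m u * starRingEnd ℂ (((1 / (2 * Real.pi) : ℝ) : ℂ) *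
        𝓕 (rotCoeff f m) (-(1 / (2 * Real.pi)) • (p • (u : ℂ))))) := by
  have hc : Continuous fun q : SE2 × Circle =>
      fourierBasis n q.2 * starRingEnd ℂ (rep p q.1 (fourierBasis m) q.2) :=
    ((continuous_fourierBasis n).comp continuous_snd).mul (Complex.continuous_conj.comp
      ((continuous_rep_uncurry m).comp ((continuous_const.prodMk continuous_fst).prodMk
      continuous_snd)))
  have hint : Integrable (fun q : SE2 × Circle => f q.1 *
      (fourierBasis n q.2 * starRingEnd ℂ (rep p q.1 (fourierBasis m) q.2)))
      (haar.prod probHaar) := by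
    refine (hi.comp_fst probHaar).mul_bdd (c := 1) hc.aestronglyMeasurable
      (Eventually.of_forall fun q => ?_)
    rw [norm_mul, RCLike.norm_conj, norm_rep_fourierBasis, norm_fourierBasis, one_mul]
  have ht : ∀ g, repEntry p n m g⁻¹
      = ∫ u, fourierBasis n u * starRingEnd ℂ (rep p g (fourierBasis m) u) ∂probHaar := fun g => by
    rw [repEntry, circleInner_rep_left, inv_inv, circleInner_eq]
  rw [fourierEntry_eq hi, circleInner_eq]
  simp_rw [ht, ← integral_const_mul]
  rw [integral_integral_swap hint]
  refine integral_congr_ae (Eventually.of_forall fun u => ?_)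
  have h := integral_mul_conj_rep hi p m u
  simp only [map_mul, Complex.conj_conj] at h ⊢
  rw [← h, ← integral_const_mul]
  exact integral_congr_ae (Eventually.of_forall fun g => mul_left_comm _ _ _)

theorem tsum_enorm_fourierEntry_sq (hi : Integrable f haar) (p : ℝ) (m : ℤ) :
    ∑' n : ℤ, ‖fourierEntry f p n m‖ₑ ^ 2 = ∫⁻ u : Circle, ‖((1 / (2 * Real.pi) : ℝ) : ℂ) *
        𝓕 (rotCoeff f m) (-(1 / (2 * Real.pi)) • (p • (u : ℂ)))‖ₑ ^ 2 ∂probHaar := by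
  have hc : Continuous fun u : Circle => fourierBasis m u *
      starRingEnd ℂ (((1 / (2 * Real.pi) : ℝ) : ℂ) *
        𝓕 (rotCoeff f m) (-(1 / (2 * Real.pi)) • (p • (u : ℂ)))) :=
    (continuous_fourierBasis m).mul (Complex.continuous_conj.comp (continuous_const.mul
      ((continuous_fourier_of_integrable (integrable_rotCoeff hi m)).comp
        ((continuous_const_smul _).comp ((continuous_const_smul p).comp continuous_coe_circle)))))
  have h := tsum_enorm_circleInner_sq (memLp_of_continuous hc)
  refine Eq.trans (tsum_congr fun n => ?_) (h.trans (lintegral_congr fun u => ?_))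
  · rw [fourierEntry_eq_circleInner hi, ← circleInner_conj, RCLike.enorm_conj]
  · rw [enorm_mul, RCLike.enorm_conj, ← ofReal_norm (fourierBasis m u), norm_fourierBasis,
      ENNReal.ofReal_one, one_mul]

theorem lintegral_lintegral_mk (hf : Measurable f) :
    ∫⁻ x, ∫⁻ R, ‖f (mk x R)‖ₑ ^ 2 ∂probHaar
      = ENNReal.ofReal (2 * Real.pi) * ∫⁻ g, ‖f g‖ₑ ^ 2 ∂haar := by
  have hm : Measurable fun q : Circle × ℂ => ‖f (mk q.2 q.1)‖ₑ ^ 2 :=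
    (hf.comp continuous_ofPair.measurable).enorm.pow_const 2
  rw [lintegral_haar (hf.enorm.pow_const 2), ← mul_assoc, ← ENNReal.ofReal_mul (by positivity),
    mul_one_div_cancel (by positivity), ENNReal.ofReal_one, one_mul]
  exact (lintegral_lintegral_swap hm.aemeasurable).symm

theorem tsum_lintegral_rotCoeff (hf : Measurable f) (hi : Integrable f haar)
    (hf₂ : ∫⁻ g, ‖f g‖ₑ ^ 2 ∂haar ≠ ∞) :
    ∑' m : ℤ, ∫⁻ x, ‖rotCoeff f m x‖ₑ ^ 2
      = ENNReal.ofReal (2 * Real.pi) * ∫⁻ g, ‖f g‖ₑ ^ 2 ∂haar := by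
  have hm : Measurable fun q : ℂ × Circle => f (mk q.1 q.2) := hf.comp continuous_mk.measurable
  have hfin : ∀ᵐ x : ℂ, ∫⁻ R, ‖f (mk x R)‖ₑ ^ 2 ∂probHaar < ∞ := by
    refine ae_lt_top (hm.enorm.pow_const 2).lintegral_prod_right' ?_
    rw [lintegral_lintegral_mk hf]
    exact ENNReal.mul_ne_top ENNReal.ofReal_ne_top hf₂
  rw [← lintegral_lintegral_mk hf, ← lintegral_tsum fun m =>
    ((integrable_rotCoeff hi m).1.enorm.pow_const 2)]
  refine lintegral_congr_ae ?_
  filter_upwards [hfin] with x hx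
  have hL : MemLp (fun R => f (mk x R)) 2 probHaar := by
    refine ⟨(hm.comp measurable_prodMk_left).aestronglyMeasurable, ?_⟩
    rw [← eLpNorm_two_sq] at hx
    by_contra h
    simp [not_lt_top_iff.1 h] at hx
  rw [← tsum_enorm_circleInner_sq hL, ← (Equiv.neg ℤ).tsum_eq]
  refine tsum_congr fun m => ?_
  rw [rotCoeff_eq, Equiv.neg_apply, neg_neg]

/-- **Plancherel's formula** for the group of rigid motions of the plane. -/
theorem tsum_lintegral_fourierEntry_sq (hf : Measurable f) (hi : Integrable f haar)
    (hf₂ : ∫⁻ g, ‖f g‖ₑ ^ 2 ∂haar ≠ ∞) :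
    ∑' m : ℤ, ∑' n : ℤ, ∫⁻ p in Set.Ioi (0 : ℝ), ‖fourierEntry f p n m‖ₑ ^ 2 * ENNReal.ofReal p
      = ∫⁻ g, ‖f g‖ₑ ^ 2 ∂haar := by
  have hpi : ENNReal.ofReal (2 * Real.pi) ≠ 0 := by simp [Real.pi_pos]
  have hsum := tsum_lintegral_rotCoeff hf hi hf₂
  -- The factor `2π` of polar coordinates is the one in `tsum_lintegral_rotCoeff`, so the two cancel
  -- at the end.
  have hterm : ∀ m : ℤ, ENNReal.ofReal (2 * Real.pi) * ∑' n : ℤ,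
      ∫⁻ p in Set.Ioi (0 : ℝ), ‖fourierEntry f p n m‖ₑ ^ 2 * ENNReal.ofReal p
      = ∫⁻ x, ‖rotCoeff f m x‖ₑ ^ 2 := fun m => by
    have hL : MemLp (rotCoeff f m) 2 := by
      refine ⟨(integrable_rotCoeff hi m).1, ?_⟩
      have h : ∫⁻ x, ‖rotCoeff f m x‖ₑ ^ 2 ≠ ∞ := ENNReal.ne_top_of_tsum_ne_top
        (hsum.trans_ne (ENNReal.mul_ne_top ENNReal.ofReal_ne_top hf₂)) m
      rw [← eLpNorm_two_sq] at h
      by_contra h'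
      simp [not_lt_top_iff.1 h'] at h
    have hF : Measurable (𝓕 (rotCoeff f m)) :=
      (continuous_fourier_of_integrable (integrable_rotCoeff hi m)).measurable
    rw [← lintegral_enorm_sq_fourier (integrable_rotCoeff hi m) hL,
      ← lintegral_enorm_sq_dilate (r := 1 / (2 * Real.pi)) (by positivity) hF,
      ← lintegral_polar, ← lintegral_tsum]
    · simp_rw [ENNReal.tsum_mul_right, tsum_enorm_fourierEntry_sq hi]
    · exact fun n => (((stronglyMeasurable_fourierEntry hi n m).measurable.enorm.pow_const 2).mul
        ENNReal.measurable_ofReal).aemeasurable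
    · exact ((measurable_const.mul (hF.comp (measurable_const_smul _))).enorm.pow_const 2)
  simp_rw [← hterm, ENNReal.tsum_mul_left] at hsum
  exact (ENNReal.mul_right_inj hpi ENNReal.ofReal_ne_top).1 hsum

end SE2

end

/-! ### Polarized Plancherel formula -/

noncomputable section

theorem memLp_two_iff_lintegral {α : Type*} [MeasurableSpace α] {μ : Measure α} {f : α → ℂ}
    (hf : AEStronglyMeasurable f μ) : MemLp f 2 μ ↔ ∫⁻ x, ‖f x‖ₑ ^ 2 ∂μ ≠ ∞ := by
  rw [← eLpNorm_two_sq, MemLp, lt_top_iff_ne_top]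
  simp [hf]

/-- The sums of `i ^ k` and of `i ^ (2k)` over four consecutive `k` vanish, which removes every term
except `a conj b`. -/
theorem Complex.polarization (a b : ℂ) :
    a * starRingEnd ℂ b = ∑ k ∈ Finset.range 4, (Complex.I ^ k / 4) *
      ((a + Complex.I ^ k * b) * starRingEnd ℂ (a + Complex.I ^ k * b)) := by
  have h3 : Complex.I ^ 3 = -Complex.I := by rw [pow_succ, Complex.I_sq]; ring
  simp only [Finset.sum_range_succ, Finset.sum_range_zero, map_add, map_mul, map_pow,
    Complex.conj_I, h3, pow_zero, pow_one, Complex.I_sq, neg_pow Complex.I]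
  linear_combination (a * starRingEnd ℂ b / 2 - b * starRingEnd ℂ a / 2) * Complex.I_sq

namespace SE2

variable {f f₁ f₂ : SE2 → ℂ}

theorem fourierEntry_add_const_mul (hi₁ : Integrable f₁ haar) (hi₂ : Integrable f₂ haar) (c : ℂ)
    (p : ℝ) (n m : ℤ) :
    fourierEntry (fun g => f₁ g + c * f₂ g) p n m
      = fourierEntry f₁ p n m + c * fourierEntry f₂ p n m := by
  have hb : ∀ {f : SE2 → ℂ}, Integrable f haar →
      Integrable (fun g => f g * repEntry p n m g⁻¹) haar := fun hf =>
    hf.mul_bdd (c := 1) ((measurable_repEntry p n m).comp measurable_inv).aestronglyMeasurable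
      (Eventually.of_forall fun g => norm_repEntry_le p n m _)
  rw [fourierEntry_eq (f := fun g => f₁ g + c * f₂ g) (hi₁.add (hi₂.const_mul c)), fourierEntry_eq hi₁, fourierEntry_eq hi₂,
    ← integral_const_mul, ← integral_add (hb hi₁) ((hb hi₂).const_mul c)]
  refine integral_congr_ae (Eventually.of_forall fun g => ?_)
  simp only
  ring

theorem fourierEntry_congr (hi₁ : Integrable f₁ haar) (h : f₁ =ᵐ[haar] f₂) (p : ℝ) (n m : ℤ) :
    fourierEntry f₁ p n m = fourierEntry f₂ p n m := by
  rw [fourierEntry_eq hi₁, fourierEntry_eq (hi₁.congr h)]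
  exact integral_congr_ae (by filter_upwards [h] with g hg using by rw [hg])

theorem lintegral_fourierEntry_sq_le (hf : Measurable f) (hi : Integrable f haar)
    (hf₂ : MemLp f 2 haar) (n m : ℤ) :
    ∫⁻ p in Set.Ioi (0 : ℝ), ‖fourierEntry f p n m‖ₑ ^ 2 * ENNReal.ofReal p
      ≤ ∫⁻ g, ‖f g‖ₑ ^ 2 ∂haar := by
  rw [← tsum_lintegral_fourierEntry_sq hf hi ((memLp_two_iff_lintegral hf₂.1).1 hf₂)]
  exact (ENNReal.le_tsum (f := fun n : ℤ => ∫⁻ p in Set.Ioi (0 : ℝ),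
    ‖fourierEntry f p n m‖ₑ ^ 2 * ENNReal.ofReal p) n).trans (ENNReal.le_tsum (f := fun m : ℤ =>
      ∑' n : ℤ, ∫⁻ p in Set.Ioi (0 : ℝ), ‖fourierEntry f p n m‖ₑ ^ 2 * ENNReal.ofReal p) m)

theorem mul_conj_mul_eq_ofReal (z : ℂ) (p : ℝ) :
    z * starRingEnd ℂ z * (p : ℂ) = ((‖z‖ ^ 2 * p : ℝ) : ℂ) := by
  rw [Complex.mul_conj, Complex.normSq_eq_norm_sq]
  push_cast
  ring

theorem lintegral_ofReal_norm_sq_mul (f : SE2 → ℂ) (n m : ℤ) :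
    ∫⁻ p in Set.Ioi (0 : ℝ), ENNReal.ofReal (‖fourierEntry f p n m‖ ^ 2 * p)
      = ∫⁻ p in Set.Ioi (0 : ℝ), ‖fourierEntry f p n m‖ₑ ^ 2 * ENNReal.ofReal p := by
  refine lintegral_congr fun p => ?_
  rw [ENNReal.ofReal_mul (sq_nonneg _), enorm_sq_eq_ofReal]

theorem integrableOn_fourierEntry_sq (hf : Measurable f) (hi : Integrable f haar)
    (hf₂ : MemLp f 2 haar) (n m : ℤ) :
    IntegrableOn (fun p : ℝ => ‖fourierEntry f p n m‖ ^ 2 * p) (Set.Ioi 0) := by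
  refine ⟨(((stronglyMeasurable_fourierEntry hi n m).measurable.norm.pow_const 2).mul
    measurable_id).aestronglyMeasurable, ?_⟩
  rw [hasFiniteIntegral_iff_ofReal ?_, lintegral_ofReal_norm_sq_mul]
  · exact (lintegral_fourierEntry_sq_le hf hi hf₂ n m).trans_lt
      ((memLp_two_iff_lintegral hf₂.1).1 hf₂).lt_top
  · filter_upwards [ae_restrict_mem measurableSet_Ioi] with p hp
    exact mul_nonneg (sq_nonneg _) (le_of_lt hp)

/-- Nonnegativity turns the iterated sum in `[0,∞]` into an unconditional sum over pairs. -/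
theorem hasSum_integral_fourierEntry_mul_conj_self (hf : Measurable f) (hi : Integrable f haar)
    (hf₂ : MemLp f 2 haar) :
    HasSum (fun q : ℤ × ℤ => ∫ p in Set.Ioi (0 : ℝ),
      fourierEntry f p q.1 q.2 * starRingEnd ℂ (fourierEntry f p q.1 q.2) * (p : ℂ))
      (∫ g, f g * starRingEnd ℂ (f g) ∂haar) := by
  have hfin := (memLp_two_iff_lintegral hf₂.1).1 hf₂
  have hself : ∀ z : ℂ, z * starRingEnd ℂ z = ((‖z‖ ^ 2 : ℝ) : ℂ) := fun z => by
    rw [Complex.mul_conj, Complex.normSq_eq_norm_sq]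
  simp_rw [mul_conj_mul_eq_ofReal, hself, integral_complex_ofReal]
  refine Complex.hasSum_ofReal.2 ?_
  have hnn : ∀ n m : ℤ, 0 ≤ᵐ[volume.restrict (Set.Ioi (0 : ℝ))]
      fun p : ℝ => ‖fourierEntry f p n m‖ ^ 2 * p := fun n m => by
    filter_upwards [ae_restrict_mem measurableSet_Ioi] with p hp
    exact mul_nonneg (sq_nonneg _) (le_of_lt hp)
  have h := tsum_lintegral_fourierEntry_sq hf hi hfin
  rw [ENNReal.tsum_comm, ← ENNReal.tsum_prod] at h
  have ht : ∀ n m : ℤ, ∫ p in Set.Ioi (0 : ℝ), ‖fourierEntry f p n m‖ ^ 2 * p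
      = (∫⁻ p in Set.Ioi (0 : ℝ), ‖fourierEntry f p n m‖ₑ ^ 2 * ENNReal.ofReal p).toReal :=
    fun n m => by
      rw [integral_eq_lintegral_of_nonneg_ae (hnn n m)
        (integrableOn_fourierEntry_sq hf hi hf₂ n m).1, lintegral_ofReal_norm_sq_mul]
  have hr : ∫ g, ‖f g‖ ^ 2 ∂haar = (∫⁻ g, ‖f g‖ₑ ^ 2 ∂haar).toReal := by
    rw [integral_eq_lintegral_of_nonneg_ae (Eventually.of_forall fun g => sq_nonneg _)
      (hf.norm.pow_const 2).aestronglyMeasurable]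
    simp_rw [enorm_sq_eq_ofReal]
  simp_rw [ht]
  have hs := ENNReal.hasSum_toReal (h.trans_ne hfin)
  rw [← ENNReal.tsum_toReal_eq (ENNReal.ne_top_of_tsum_ne_top (h.trans_ne hfin)), h] at hs
  rwa [hr]

/-- The polarized form of **Plancherel's formula** for the group of rigid motions. -/
theorem hasSum_integral_fourierEntry_mul_conj (hf₁ : Measurable f₁) (hi₁ : Integrable f₁ haar)
    (hL₁ : MemLp f₁ 2 haar) (hf₂ : Measurable f₂) (hi₂ : Integrable f₂ haar)
    (hL₂ : MemLp f₂ 2 haar) :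
    HasSum (fun q : ℤ × ℤ => ∫ p in Set.Ioi (0 : ℝ),
      fourierEntry f₁ p q.1 q.2 * starRingEnd ℂ (fourierEntry f₂ p q.1 q.2) * (p : ℂ))
      (∫ g, f₁ g * starRingEnd ℂ (f₂ g) ∂haar) := by
  let F : ℕ → SE2 → ℂ := fun k g => f₁ g + Complex.I ^ k * f₂ g
  have hF : ∀ k, Measurable (F k) := fun k => hf₁.add (hf₂.const_mul _)
  have hFi : ∀ k, Integrable (F k) haar := fun k => hi₁.add (hi₂.const_mul _)
  have hFL : ∀ k, MemLp (F k) 2 haar := fun k => hL₁.add (hL₂.const_mul _)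
  have h := hasSum_sum (s := Finset.range 4) fun k _ =>
    (hasSum_integral_fourierEntry_mul_conj_self (hF k) (hFi k) (hFL k)).mul_left
      (Complex.I ^ k / 4)
  have hself : ∀ z : ℂ, z * starRingEnd ℂ z = ((‖z‖ ^ 2 : ℝ) : ℂ) := fun z => by
    rw [Complex.mul_conj, Complex.normSq_eq_norm_sq]
  have e₁ : ∀ q : ℤ × ℤ, ∫ p in Set.Ioi (0 : ℝ),
      fourierEntry f₁ p q.1 q.2 * starRingEnd ℂ (fourierEntry f₂ p q.1 q.2) * (p : ℂ)
      = ∑ k ∈ Finset.range 4, Complex.I ^ k / 4 * ∫ p in Set.Ioi (0 : ℝ),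
        fourierEntry (F k) p q.1 q.2 * starRingEnd ℂ (fourierEntry (F k) p q.1 q.2) * (p : ℂ) := by
    intro q
    simp_rw [← integral_const_mul]
    rw [← integral_finsetSum]
    · refine integral_congr_ae (Eventually.of_forall fun p => ?_)
      simp only [F, fourierEntry_add_const_mul hi₁ hi₂]
      rw [Complex.polarization, Finset.sum_mul]
      exact Finset.sum_congr rfl fun k _ => by ring
    · intro k _
      simp_rw [mul_conj_mul_eq_ofReal]
      exact (integrableOn_fourierEntry_sq (hF k) (hFi k) (hFL k) q.1 q.2).ofReal.const_mul _
  have e₂ : ∫ g, f₁ g * starRingEnd ℂ (f₂ g) ∂haar = ∑ k ∈ Finset.range 4,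
      Complex.I ^ k / 4 * ∫ g, F k g * starRingEnd ℂ (F k g) ∂haar := by
    simp_rw [← integral_const_mul]
    rw [← integral_finsetSum]
    · exact integral_congr_ae (Eventually.of_forall fun g => Complex.polarization _ _)
    · intro k _
      simp_rw [hself]
      exact (hFL k).norm.integrable_sq.ofReal.const_mul _
  rw [e₂]
  exact h.congr_fun e₁

end SE2

end

/-! ### Truncated kernels, coefficients and the expansion -/

noncomputable section

namespace SE2

variable {f f₁ f₂ : SE2 → ℂ}

/-! ### Truncations to compact sets -/

/-- The integral translation by `a + b i`. -/
def latticeTranslation (a b : ℤ) : lattice := ⟨mk ((a : ℂ) + (b : ℂ) * Complex.I) 1, ⟨a, b, rfl⟩, rfl⟩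

theorem latticeTranslation_mul_mem_domain (g : SE2) :
    (latticeTranslation (-⌊g.trans.re⌋) (-⌊g.trans.im⌋) : SE2) * g ∈ domain := by
  have h₁ := Int.floor_le g.trans.re
  have h₂ := Int.lt_floor_add_one g.trans.re
  have h₃ := Int.floor_le g.trans.im
  have h₄ := Int.lt_floor_add_one g.trans.im
  constructor <;> constructor <;> simp [latticeTranslation] <;> linarith

theorem exists_finset_lattice_of_isCompact {K : Set SE2} (hK : IsCompact K) :
    ∃ S : Finset lattice, K ⊆ ⋃ γ : S, (fun g => ((γ : lattice) : SE2) * g) ⁻¹' domain := by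
  classical
  obtain ⟨r, hr⟩ := (hK.image continuous_trans).isBounded.exists_norm_le
  refine ⟨(Finset.Icc ⌊-r⌋ ⌊r⌋ ×ˢ Finset.Icc ⌊-r⌋ ⌊r⌋).image
    fun q => latticeTranslation (-q.1) (-q.2), fun g hg => ?_⟩
  have hg' := hr _ ⟨g, hg, rfl⟩
  have hre := abs_le.1 ((Complex.abs_re_le_norm g.trans).trans hg')
  have him := abs_le.1 ((Complex.abs_im_le_norm g.trans).trans hg')
  refine Set.mem_iUnion.2 ⟨⟨_, Finset.mem_image.2 ⟨(⌊g.trans.re⌋, ⌊g.trans.im⌋), ?_, rfl⟩⟩,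
    latticeTranslation_mul_mem_domain g⟩
  simp only [Finset.mem_product, Finset.mem_Icc]
  exact ⟨⟨Int.floor_le_floor hre.1, Int.floor_le_floor hre.2⟩,
    ⟨Int.floor_le_floor him.1, Int.floor_le_floor him.2⟩⟩

/-- Finitely many lattice translates of the domain cover `K`, and each contributes the full integral
over the coset space. -/
theorem setLIntegral_comp_toCoset_lt_top {K : Set SE2} (hK : IsCompact K) {a : Coset → ℝ≥0∞}
    (ha : Measurable a) (ha' : ∫⁻ x, a x ∂cosetMeasure ≠ ∞) :
    ∫⁻ g in K, a (toCoset g) ∂haar < ∞ := by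
  obtain ⟨S, hS⟩ := exists_finset_lattice_of_isCompact hK
  have hγ : ∀ γ : lattice, ∫⁻ g in (fun g => (γ : SE2) * g) ⁻¹' domain, a (toCoset g) ∂haar
      = ∫⁻ x, a x ∂cosetMeasure := fun γ => by
    rw [lintegral_cosetMeasure_eq ha,
      ← (measurePreserving_lattice γ).setLIntegral_comp_preimage_emb
        (measurableEmbedding_mulLeft (γ : SE2)) (fun g => a (toCoset g)) domain]
    simp_rw [toCoset_mul]
  calc ∫⁻ g in K, a (toCoset g) ∂haar
      ≤ ∑' γ : S, ∫⁻ g in (fun g => ((γ : lattice) : SE2) * g) ⁻¹' domain, a (toCoset g) ∂haar :=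
        (lintegral_mono_set hS).trans (lintegral_iUnion_le _ _)
    _ < ∞ := by
        simp_rw [hγ, tsum_fintype]
        exact ENNReal.sum_lt_top.2 fun _ _ => ha'.lt_top

theorem lintegral_cosetMeasure_one_ne_top : ∫⁻ _, 1 ∂cosetMeasure ≠ ∞ := by
  have hD : MeasurableSet {z : ℂ | z.re ∈ Set.Ico (0 : ℝ) 1 ∧ z.im ∈ Set.Ico (0 : ℝ) 1} :=
    (Complex.measurable_re measurableSet_Ico).inter (Complex.measurable_im measurableSet_Ico)
  have hb : Bornology.IsBounded {z : ℂ | z.re ∈ Set.Ico (0 : ℝ) 1 ∧ z.im ∈ Set.Ico (0 : ℝ) 1} := by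
    refine isBounded_iff_forall_norm_le.2 ⟨2, fun z hz => ?_⟩
    refine (Complex.norm_le_abs_re_add_abs_im z).trans ?_
    have h₁ := hz.1.1
    have h₂ := hz.1.2
    have h₃ := hz.2.1
    have h₄ := hz.2.2
    rw [abs_of_nonneg h₁, abs_of_nonneg h₃]
    linarith
  rw [lintegral_cosetMeasure_eq measurable_const, ← lintegral_indicator measurableSet_domain,
    lintegral_haar (measurable_const.indicator measurableSet_domain)]
  refine ENNReal.mul_ne_top ENNReal.ofReal_ne_top ?_
  have h : ∀ R, ∫⁻ x, domain.indicator (fun _ => 1) (mk x R) = volume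
      {z : ℂ | z.re ∈ Set.Ico (0 : ℝ) 1 ∧ z.im ∈ Set.Ico (0 : ℝ) 1} := fun R => by
    rw [← lintegral_indicator_one hD]
    rfl
  simp_rw [h, lintegral_const, measure_univ, mul_one]
  exact hb.measure_lt_top.ne

section Truncation

variable {K : Set SE2} {ψ : Coset → ℂ}

theorem measurable_truncation (hK : IsCompact K) (hψ : Measurable ψ) :
    Measurable (K.indicator fun g => ψ (toCoset g)) :=
  (hψ.comp measurable_toCoset).indicator hK.measurableSet

theorem enorm_truncation_sq (K : Set SE2) (ψ : Coset → ℂ) (g : SE2) :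
    ‖K.indicator (fun g => ψ (toCoset g)) g‖ₑ ^ 2
      = K.indicator (fun g => ‖ψ (toCoset g)‖ₑ ^ 2) g := by
  by_cases hg : g ∈ K <;> simp [hg]

/-- Together with `integrable_truncation` this puts the truncation of `ψ` in `L¹ ∩ L²`, where
Plancherel's formula applies. -/
theorem memLp_truncation (hK : IsCompact K) (hψ : Measurable ψ) (hL : MemLp ψ 2 cosetMeasure) :
    MemLp (K.indicator fun g => ψ (toCoset g)) 2 haar := by
  rw [memLp_two_iff_lintegral (measurable_truncation hK hψ).aestronglyMeasurable]
  simp_rw [enorm_truncation_sq]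
  rw [lintegral_indicator hK.measurableSet]
  exact (setLIntegral_comp_toCoset_lt_top hK (hψ.enorm.pow_const 2)
    ((memLp_two_iff_lintegral hL.1).1 hL)).ne

theorem integrable_truncation (hK : IsCompact K) (hψ : Measurable ψ)
    (hL : MemLp ψ 2 cosetMeasure) :
    Integrable (K.indicator fun g => ψ (toCoset g)) haar := by
  rw [integrable_indicator_iff hK.measurableSet]
  have hfin : IsFiniteMeasure (haar.restrict K) := by
    refine ⟨?_⟩
    have := setLIntegral_comp_toCoset_lt_top hK (a := fun _ => 1) measurable_const
      lintegral_cosetMeasure_one_ne_top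
    rwa [lintegral_one] at this
  exact ((memLp_indicator_iff_restrict hK.measurableSet).1
    (memLp_truncation hK hψ hL)).integrable one_le_two

end Truncation

/-! ### Integrals against periodizations -/

/-- Weil's formula and the inclusion of `ℓ¹` in `ℓ²` along each coset. -/
theorem memLp_of_absPeriodization (hf : Measurable f)
    (hper : MemLp (absPeriodization f) 2 cosetMeasure) : MemLp f 2 haar := by
  rw [memLp_two_iff_lintegral hf.aestronglyMeasurable]
  refine ne_of_lt ?_
  rw [← lintegral_cosetMeasure (hf.enorm.pow_const 2)]
  have hlt : ∫⁻ x, absPeriodization f x ^ 2 ∂cosetMeasure < ∞ := by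
    have h := ENNReal.pow_lt_top (n := 2) hper.2
    rw [eLpNorm_two_sq] at h
    simpa using h
  refine lt_of_le_of_lt (lintegral_mono fun x => ?_) hlt
  induction x using Quotient.inductionOn with | h g => ?_
  change ∑' γ : lattice, ‖f ((γ : SE2) * g)‖ₑ ^ 2 ≤ (∑' γ : lattice, ‖f ((γ : SE2) * g)‖ₑ) ^ 2
  simp_rw [sq]
  rw [← ENNReal.tsum_mul_right]
  refine ENNReal.tsum_le_tsum fun γ => ?_
  gcongr
  exact ENNReal.le_tsum (f := fun γ : lattice => ‖f ((γ : SE2) * g)‖ₑ) γ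

/-- By Weil's formula this is a product of two `L²` functions on the coset space. Applied to `f₁ ⋆
f₂`, it makes the untruncated coefficient absolutely convergent. -/
theorem integrable_mul_comp_toCoset (hf : Measurable f)
    (hper : MemLp (absPeriodization f) 2 cosetMeasure) {b : Coset → ℂ} (hb : Measurable b)
    (hL : MemLp b 2 cosetMeasure) : Integrable (fun g => f g * b (toCoset g)) haar := by
  refine ⟨(hf.mul (hb.comp measurable_toCoset)).aestronglyMeasurable, ?_⟩
  simp_rw [HasFiniteIntegral, enorm_mul]
  rw [lintegral_mul_comp_toCoset (a := fun x => ‖b x‖ₑ) hf.enorm hb.enorm]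
  have h₁ : ∫⁻ x, absPeriodization f x ^ 2 ∂cosetMeasure < ∞ := by
    have h := ENNReal.pow_lt_top (n := 2) hper.2
    rw [eLpNorm_two_sq] at h
    simpa using h
  have h₂ := ((memLp_two_iff_lintegral hL.1).1 hL).lt_top
  have h : 2 * ∫⁻ x, absPeriodization f x * ‖b x‖ₑ ∂cosetMeasure < ∞ := by
    rw [← lintegral_const_mul' _ _ ENNReal.ofNat_ne_top]
    refine lt_of_le_of_lt (lintegral_mono fun x => ENNReal.mul_le_half_sq_add_sq _ _) ?_
    rw [lintegral_add_left ((measurable_absPeriodization hf).pow_const 2)]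
    exact ENNReal.add_lt_top.2 ⟨h₁, h₂⟩
  exact ENNReal.lt_top_of_mul_ne_top_right h.ne two_ne_zero

/-- Weil's formula for the product of a function on the group with one on the coset space. -/
theorem integral_mul_comp_toCoset (hf : Measurable f) (hi : Integrable f haar) {b : Coset → ℂ}
    (hb : Measurable b) (hint : Integrable (fun g => f g * b (toCoset g)) haar) :
    ∫ g, f g * b (toCoset g) ∂haar = ∫ x, periodization f x * b x ∂cosetMeasure := by
  have hmap : ∫ x, periodization f x * b x ∂cosetMeasure
      = ∫ g in domain, periodization f (toCoset g) * b (toCoset g) ∂haar :=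
    integral_map measurable_toCoset.aemeasurable
      ((aestronglyMeasurable_periodization hf hi).mul hb.aestronglyMeasurable)
  rw [isFundamentalDomain_domain.integral_eq_tsum'' _ hint, hmap]
  simp_rw [periodization_toCoset, ← tsum_mul_right, Subgroup.smul_def, smul_eq_mul, toCoset_mul]
  refine (integral_tsum (fun γ => ((hf.comp (measurable_const_mul _)).mul
    (hb.comp measurable_toCoset)).aestronglyMeasurable) ?_).symm
  have h := isFundamentalDomain_domain.lintegral_eq_tsum'' fun g => ‖f g * b (toCoset g)‖ₑ
  simp_rw [Subgroup.smul_def, smul_eq_mul, toCoset_mul] at h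
  exact (h.symm.trans_lt hint.2).ne

/-! ### The coefficients of the expansion -/

section Coefficients

variable {K : Set SE2} {ψ : Coset → ℂ}

/-- The product is split as `|f̂₁|` times `|f̂₂ Ĝ|`. The first squares are summable over `k` by
Plancherel for `f₁`; in the second, the sum over `k` of `|f̂₂|²` is at most `‖f₂‖₁²`, leaving
Plancherel for `G`. -/
theorem tsum_lintegral_coeffIntegrand_lt_top (hf₁ : Measurable f₁) (hf₂ : Measurable f₂)
    (hi₁ : Integrable f₁ haar) (hi₂ : Integrable f₂ haar) (hL₁ : MemLp f₁ 2 haar)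
    (hK : IsCompact K) (hψ : Measurable ψ) (hL : MemLp ψ 2 cosetMeasure) (n m : ℤ) :
    ∑' k : ℤ, ∫⁻ p in Set.Ioi (0 : ℝ), ‖coeffIntegrand K ψ f₁ f₂ n m k p‖ₑ < ∞ := by
  let G : SE2 → ℂ := K.indicator fun g => ψ (toCoset g)
  have hG : Measurable G := measurable_truncation hK hψ
  have hGi : Integrable G haar := integrable_truncation hK hψ hL
  have hGL : MemLp G 2 haar := memLp_truncation hK hψ hL
  have hm : ∀ {f : SE2 → ℂ}, Integrable f haar → ∀ n m,
      Measurable fun p : ℝ => ‖fourierEntry f p n m‖ₑ ^ 2 := fun hf n m =>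
    (stronglyMeasurable_fourierEntry hf n m).measurable.enorm.pow_const 2
  have hpt : ∀ k : ℤ, 2 * ∫⁻ p in Set.Ioi (0 : ℝ), ‖coeffIntegrand K ψ f₁ f₂ n m k p‖ₑ
      ≤ (∫⁻ p in Set.Ioi (0 : ℝ), ‖fourierEntry f₁ p n k‖ₑ ^ 2 * ENNReal.ofReal p) +
        ∫⁻ p in Set.Ioi (0 : ℝ), ‖fourierEntry f₂ p k m‖ₑ ^ 2 *
          (‖fourierEntry G p n m‖ₑ ^ 2 * ENNReal.ofReal p) := fun k => by
    rw [← lintegral_const_mul' _ _ ENNReal.ofNat_ne_top, ← lintegral_add_left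
      (f := fun p => ‖fourierEntry f₁ p n k‖ₑ ^ 2 * ENNReal.ofReal p)
      ((hm hi₁ n k).mul ENNReal.measurable_ofReal)]
    refine setLIntegral_mono' measurableSet_Ioi fun p hp => ?_
    have hp' : ‖(p : ℂ)‖ₑ = ENNReal.ofReal p := by
      rw [← ofReal_norm, Complex.norm_real, Real.norm_of_nonneg (le_of_lt hp)]
    rw [coeffIntegrand, kernelOn_eq hK.measurableSet hGi, enorm_mul, enorm_mul, enorm_mul, hp',
      RCLike.enorm_conj]
    calc _ = 2 * (‖fourierEntry f₁ p n k‖ₑ * (‖fourierEntry f₂ p k m‖ₑ * ‖fourierEntry G p n m‖ₑ))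
          * ENNReal.ofReal p := by ring
      _ ≤ (‖fourierEntry f₁ p n k‖ₑ ^ 2 + (‖fourierEntry f₂ p k m‖ₑ * ‖fourierEntry G p n m‖ₑ) ^ 2)
          * ENNReal.ofReal p := by
        gcongr
        exact ENNReal.mul_le_half_sq_add_sq _ _
      _ = _ := by ring
  have h₁ : ∑' k : ℤ, ∫⁻ p in Set.Ioi (0 : ℝ), ‖fourierEntry f₁ p n k‖ₑ ^ 2 * ENNReal.ofReal p
      < ∞ := by
    have hfin := (memLp_two_iff_lintegral hL₁.1).1 hL₁
    refine lt_of_le_of_lt (ENNReal.tsum_le_tsum fun k => ?_)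
      ((tsum_lintegral_fourierEntry_sq hf₁ hi₁ hfin).trans_lt hfin.lt_top)
    exact ENNReal.le_tsum (f := fun n : ℤ => ∫⁻ p in Set.Ioi (0 : ℝ),
      ‖fourierEntry f₁ p n k‖ₑ ^ 2 * ENNReal.ofReal p) n
  have h₂ : ∑' k : ℤ, ∫⁻ p in Set.Ioi (0 : ℝ), ‖fourierEntry f₂ p k m‖ₑ ^ 2 *
      (‖fourierEntry G p n m‖ₑ ^ 2 * ENNReal.ofReal p) < ∞ := by
    rw [← lintegral_tsum (f := fun (k : ℤ) p => ‖fourierEntry f₂ p k m‖ₑ ^ 2 *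
      (‖fourierEntry G p n m‖ₑ ^ 2 * ENNReal.ofReal p)) fun k => ((hm hi₂ k m).mul
      ((hm hGi n m).mul ENNReal.measurable_ofReal)).aemeasurable]
    simp_rw [ENNReal.tsum_mul_right]
    calc _ ≤ ∫⁻ p in Set.Ioi (0 : ℝ), (∫⁻ g, ‖f₂ g‖ₑ ∂haar) ^ 2 *
          (‖fourierEntry G p n m‖ₑ ^ 2 * ENNReal.ofReal p) := by
          refine lintegral_mono fun p => ?_
          gcongr
          exact tsum_enorm_fourierEntry_sq_le hf₂ hi₂ p m
      _ = (∫⁻ g, ‖f₂ g‖ₑ ∂haar) ^ 2 * ∫⁻ p in Set.Ioi (0 : ℝ),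
          ‖fourierEntry G p n m‖ₑ ^ 2 * ENNReal.ofReal p :=
        lintegral_const_mul _ ((hm hGi n m).mul ENNReal.measurable_ofReal)
      _ < ∞ := ENNReal.mul_lt_top (ENNReal.pow_lt_top hi₂.2)
        ((lintegral_fourierEntry_sq_le hG hGi hGL n m).trans_lt
          ((memLp_two_iff_lintegral hGL.1).1 hGL).lt_top)
  have h : 2 * ∑' k : ℤ, ∫⁻ p in Set.Ioi (0 : ℝ), ‖coeffIntegrand K ψ f₁ f₂ n m k p‖ₑ < ∞ := by
    rw [← ENNReal.tsum_mul_left]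
    refine lt_of_le_of_lt (ENNReal.tsum_le_tsum hpt) ?_
    rw [ENNReal.tsum_add]
    exact ENNReal.add_lt_top.2 ⟨h₁, h₂⟩
  exact ENNReal.lt_top_of_mul_ne_top_right h.ne two_ne_zero

theorem measurable_coeffIntegrand (hi₁ : Integrable f₁ haar) (hi₂ : Integrable f₂ haar)
    (hK : IsCompact K) (hψ : Measurable ψ) (hL : MemLp ψ 2 cosetMeasure) (n m k : ℤ) :
    Measurable (coeffIntegrand K ψ f₁ f₂ n m k) := by
  have hGi := integrable_truncation hK hψ hL
  have h : coeffIntegrand K ψ f₁ f₂ n m k = fun p => fourierEntry f₁ p n k * fourierEntry f₂ p k m *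
      starRingEnd ℂ (fourierEntry (K.indicator fun g => ψ (toCoset g)) p n m) * (p : ℂ) := by
    funext p
    rw [coeffIntegrand, kernelOn_eq hK.measurableSet hGi]
  rw [h]
  exact (((stronglyMeasurable_fourierEntry hi₁ n k).measurable.mul
    (stronglyMeasurable_fourierEntry hi₂ k m).measurable).mul
    (Complex.continuous_conj.measurable.comp
      (stronglyMeasurable_fourierEntry hGi n m).measurable)).mul Complex.measurable_ofReal

theorem integrableOn_coeffIntegrand (hf₁ : Measurable f₁) (hf₂ : Measurable f₂)
    (hi₁ : Integrable f₁ haar) (hi₂ : Integrable f₂ haar) (hL₁ : MemLp f₁ 2 haar)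
    (hK : IsCompact K) (hψ : Measurable ψ) (hL : MemLp ψ 2 cosetMeasure) (n m k : ℤ) :
    IntegrableOn (coeffIntegrand K ψ f₁ f₂ n m k) (Set.Ioi 0) :=
  ⟨(measurable_coeffIntegrand hi₁ hi₂ hK hψ hL n m k).aestronglyMeasurable,
    (ENNReal.ne_top_of_tsum_ne_top (tsum_lintegral_coeffIntegrand_lt_top hf₁ hf₂ hi₁ hi₂ hL₁ hK
      hψ hL n m).ne k).lt_top⟩

theorem hasSum_coeffTerm (hf₁ : Measurable f₁) (hf₂ : Measurable f₂)
    (hi₁ : Integrable f₁ haar) (hi₂ : Integrable f₂ haar) (hL₁ : MemLp f₁ 2 haar)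
    (hK : IsCompact K) (hψ : Measurable ψ) (hL : MemLp ψ 2 cosetMeasure) (n m : ℤ) :
    HasSum (fun k => coeffTerm K ψ f₁ f₂ n m k)
      (∫ p in Set.Ioi (0 : ℝ), fourierEntry (conv f₁ f₂) p n m *
        starRingEnd ℂ (fourierEntry (K.indicator fun g => ψ (toCoset g)) p n m) * (p : ℂ)) := by
  refine hasSum_integral_of_tsum_lintegral
    (fun k => (measurable_coeffIntegrand hi₁ hi₂ hK hψ hL n m k).aestronglyMeasurable)
    (tsum_lintegral_coeffIntegrand_lt_top hf₁ hf₂ hi₁ hi₂ hL₁ hK hψ hL n m).ne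
    (Eventually.of_forall fun p => ?_)
  simp_rw [coeffIntegrand, kernelOn_eq hK.measurableSet (integrable_truncation hK hψ hL)]
  exact ((hasSum_fourierEntry_mul hf₁ hf₂ hi₁ hi₂ p n m).mul_right _).mul_right _

theorem memLp_absPeriodization_conv (hf₁ : Measurable f₁) (hf₂ : Measurable f₂)
    (hi₂ : Integrable f₂ haar) (hper : MemLp (absPeriodization f₁) 2 cosetMeasure) :
    MemLp (absPeriodization (conv f₁ f₂)) 2 cosetMeasure ∧
      eLpNorm (absPeriodization (conv f₁ f₂)) 2 cosetMeasure ≤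
        eLpNorm (absPeriodization f₁) 2 cosetMeasure * eLpNorm f₂ 1 haar := by
  have h : eLpNorm (absPeriodization (conv f₁ f₂)) 2 cosetMeasure ≤
      eLpNorm (absPeriodization f₁) 2 cosetMeasure * eLpNorm f₂ 1 haar := by
    rw [eLpNorm_one_eq_lintegral_enorm]
    refine le_trans (eLpNorm_mono_enorm fun x => ?_)
      (eLpNorm_cosetLConv_le (measurable_absPeriodization hf₁) hf₂.enorm)
    simpa using absPeriodization_conv_le hf₁ hf₂ x
  refine ⟨⟨(measurable_absPeriodization (measurable_conv hf₁ hf₂)).aestronglyMeasurable,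
    h.trans_lt (ENNReal.mul_lt_top hper.2 ?_)⟩, h⟩
  rw [eLpNorm_one_eq_lintegral_enorm]
  exact hi₂.2

/-- Polarized Plancherel for `f₁ ⋆ f₂` and the truncation of `ψ`; `hasSum_coeffTerm` evaluates each
inner sum over `k`. -/
theorem hasSum_tsum_coeffTerm (hf₁ : Measurable f₁) (hf₂ : Measurable f₂)
    (hi₁ : Integrable f₁ haar) (hi₂ : Integrable f₂ haar)
    (hper : MemLp (absPeriodization f₁) 2 cosetMeasure)
    (hK : IsCompact K) (hψ : Measurable ψ) (hL : MemLp ψ 2 cosetMeasure) :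
    HasSum (fun q : ℤ × ℤ => ∑' k : ℤ, coeffTerm K ψ f₁ f₂ q.1 q.2 k)
      (∫ g in K, conv f₁ f₂ g * starRingEnd ℂ (ψ (toCoset g)) ∂haar) := by
  have hL₁ := memLp_of_absPeriodization hf₁ hper
  have hc := measurable_conv hf₁ hf₂
  have h := hasSum_integral_fourierEntry_mul_conj hc (integrable_conv hf₁ hf₂ hi₁ hi₂)
    (memLp_of_absPeriodization hc (memLp_absPeriodization_conv hf₁ hf₂ hi₂ hper).1)
    (measurable_truncation hK hψ) (integrable_truncation hK hψ hL) (memLp_truncation hK hψ hL)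
  have he : ∫ g in K, conv f₁ f₂ g * starRingEnd ℂ (ψ (toCoset g)) ∂haar
      = ∫ g, conv f₁ f₂ g * starRingEnd ℂ (K.indicator (fun g => ψ (toCoset g)) g) ∂haar := by
    rw [← integral_indicator hK.measurableSet]
    refine integral_congr_ae (Eventually.of_forall fun g => ?_)
    by_cases hg : g ∈ K <;> simp [hg]
  rw [he]
  exact h.congr_fun fun q =>
    (hasSum_coeffTerm hf₁ hf₂ hi₁ hi₂ hL₁ hK hψ hL q.1 q.2).tsum_eq

/-- Dominated convergence; the sets need not increase. -/
theorem tendsto_setIntegral_exhaustion {F : SE2 → ℂ} (hF : Integrable F haar) {K : ℕ → Set SE2}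
    (hK : IsExhaustion K) :
    Tendsto (fun j => ∫ g in K j, F g ∂haar) atTop (𝓝 (∫ g, F g ∂haar)) := by
  simp_rw [← integral_indicator (hK.1 _).measurableSet]
  refine tendsto_integral_of_dominated_convergence (fun g => ‖F g‖)
    (fun j => hF.1.indicator (hK.1 j).measurableSet) hF.norm
    (fun j => Eventually.of_forall fun g => norm_indicator_le_norm_self _ _)
    (Eventually.of_forall fun g => ?_)
  exact tendsto_const_nhds.congr' ((hK.2 g).mono fun j hj => (Set.indicator_of_mem hj _).symm)

end Coefficients

theorem memLp_conj {b : Coset → ℂ} (hL : MemLp b 2 cosetMeasure) :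
    MemLp (fun x => starRingEnd ℂ (b x)) 2 cosetMeasure :=
  hL.star

theorem expansion_of_measurable {ι : Type*} (ψ : HilbertBasis ι ℂ (Lp ℂ 2 cosetMeasure))
    (hf₁ : Measurable f₁) (hf₂ : Measurable f₂) (hi₁ : Integrable f₁ haar)
    (hi₂ : Integrable f₂ haar) (hper : MemLp (absPeriodization f₁) 2 cosetMeasure) :
    ∃ (hmem : MemLp (cosetConv (periodization f₁) f₂) 2 cosetMeasure) (c : ι → ℂ),
      (∀ (ℓ : ι) (K : ℕ → Set SE2), IsExhaustion K →
        Tendsto (fun j => ∑' n : ℤ, ∑' m : ℤ, ∑' k : ℤ, coeffTerm (K j) (ψ ℓ) f₁ f₂ n m k)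
          atTop (𝓝 (c ℓ))) ∧
      HasSum (fun ℓ => c ℓ • ψ ℓ) hmem.toLp := by
  have hc := measurable_conv hf₁ hf₂
  have hci := integrable_conv hf₁ hf₂ hi₁ hi₂
  have hcper := (memLp_absPeriodization_conv hf₁ hf₂ hi₂ hper).1
  have hψ : ∀ ℓ, Measurable (ψ ℓ) := fun ℓ => (Lp.stronglyMeasurable (ψ ℓ)).measurable
  have hψc : ∀ ℓ, Measurable fun x => starRingEnd ℂ (ψ ℓ x) := fun ℓ =>
    Complex.continuous_conj.measurable.comp (hψ ℓ)
  have hL : ∀ ℓ, MemLp (ψ ℓ) 2 cosetMeasure := fun ℓ => Lp.memLp (ψ ℓ)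
  have hae : cosetConv (periodization f₁) f₂ =ᵐ[cosetMeasure] periodization (conv f₁ f₂) := by
    filter_upwards [ae_cosetLConv_lt_top (measurable_absPeriodization hf₁) hf₂.enorm hper.2.ne
      hi₂.2.ne] with x hx using cosetConv_eq_periodization_conv hf₁ hf₂ hx
  have hmem' : MemLp (periodization (conv f₁ f₂)) 2 cosetMeasure := by
    refine ⟨aestronglyMeasurable_periodization hc hci, lt_of_le_of_lt
      (eLpNorm_mono_enorm fun x => ?_) hcper.2⟩
    simpa using enorm_periodization_le (conv f₁ f₂) x
  have hmem : MemLp (cosetConv (periodization f₁) f₂) 2 cosetMeasure := hmem'.ae_eq hae.symm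
  have hint : ∀ ℓ, Integrable (fun g => conv f₁ f₂ g * starRingEnd ℂ (ψ ℓ (toCoset g))) haar :=
    fun ℓ => integrable_mul_comp_toCoset hc hcper (hψc ℓ) (memLp_conj (hL ℓ))
  -- The witness does not involve `K`, so the limit is the same for every exhaustion.
  refine ⟨hmem, fun ℓ => ∫ g, conv f₁ f₂ g * starRingEnd ℂ (ψ ℓ (toCoset g)) ∂haar,
    fun ℓ K hK => ?_, ?_⟩
  · refine (tendsto_setIntegral_exhaustion (hint ℓ) hK).congr fun j => ?_
    have h := hasSum_tsum_coeffTerm hf₁ hf₂ hi₁ hi₂ hper (hK.1 j) (hψ ℓ) (hL ℓ)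
    rw [← h.tsum_eq, h.summable.tsum_prod]
  · refine (ψ.hasSum_repr hmem.toLp).congr_fun fun ℓ => ?_
    congr 1
    rw [ψ.repr_apply_apply, L2.inner_def]
    refine (integral_mul_comp_toCoset (b := fun x => starRingEnd ℂ (ψ ℓ x)) hc hci (hψc ℓ)
      (hint ℓ)).trans (integral_congr_ae ?_)
    filter_upwards [hmem.coeFn_toLp, hae] with x h₁ h₂
    rw [RCLike.inner_apply, h₁, h₂]

/-! ### Reduction to measurable functions -/

/-- The indicator of the exceptional null set has periodization of integral zero, so almost every
coset misses that set entirely. -/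
theorem ae_forall_lattice_eq (h : f₁ =ᵐ[haar] f₂) :
    ∀ᵐ x ∂cosetMeasure, ∀ g, toCoset g = x → ∀ γ : lattice,
      f₁ ((γ : SE2) * g) = f₂ ((γ : SE2) * g) := by
  let T : Set SE2 := toMeasurable haar {g | f₁ g ≠ f₂ g}
  have hT : MeasurableSet T := measurableSet_toMeasurable _ _
  have h0 : haar T = 0 := (measure_toMeasurable _).trans (ae_iff.1 h)
  have hm : Measurable (T.indicator (1 : SE2 → ℝ≥0∞)) := measurable_one.indicator hT
  have hz : ∫⁻ x, periodization (T.indicator (1 : SE2 → ℝ≥0∞)) x ∂cosetMeasure = 0 := by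
    rw [lintegral_cosetMeasure hm, lintegral_indicator_one hT, h0]
  filter_upwards [(lintegral_eq_zero_iff (measurable_periodization hm)).1 hz] with x hx g hg γ
  by_contra hne
  subst hg
  have hz' : ∑' γ : lattice, T.indicator (1 : SE2 → ℝ≥0∞) ((γ : SE2) * g) = 0 := hx
  have := ENNReal.tsum_eq_zero.1 hz' γ
  rw [Set.indicator_of_mem (subset_toMeasurable _ _ hne)] at this
  exact one_ne_zero this

theorem absPeriodization_congr (h : f₁ =ᵐ[haar] f₂) :
    absPeriodization f₁ =ᵐ[cosetMeasure] absPeriodization f₂ := by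
  filter_upwards [ae_forall_lattice_eq h] with x hx
  induction x using Quotient.inductionOn with | h g => ?_
  exact tsum_congr fun γ => congrArg (‖·‖ₑ) (hx g rfl γ)

theorem periodization_comp_congr (h : f₁ =ᵐ[haar] f₂) :
    (fun g => periodization f₁ (toCoset g)) =ᵐ[haar] fun g => periodization f₂ (toCoset g) := by
  filter_upwards [quasiMeasurePreserving_toCoset.ae (ae_forall_lattice_eq h)] with g hg
  exact tsum_congr fun γ => hg g rfl γ

/-- Inversion and right translation preserve `haar`, so this holds for every `x`; convolutions of
equivalent functions therefore agree at every point. -/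
theorem ae_inv_mul_eq (h : f₁ =ᵐ[haar] f₂) (x : SE2) :
    (fun g => f₁ (g⁻¹ * x)) =ᵐ[haar] fun g => f₂ (g⁻¹ * x) :=
  ((measurePreserving_mul_right_haar x).comp
    (Measure.measurePreserving_inv haar)).quasiMeasurePreserving.ae_eq_comp h

variable {f₁' f₂' : SE2 → ℂ}

theorem conv_integrand_congr (h₁ : f₁ =ᵐ[haar] f₁') (h₂ : f₂ =ᵐ[haar] f₂') (x : SE2) :
    (fun g => f₁ g * f₂ (g⁻¹ * x)) =ᵐ[haar] fun g => f₁' g * f₂' (g⁻¹ * x) :=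
  h₁.mul (ae_inv_mul_eq h₂ x)

theorem cosetConv_integrand_congr (h₁ : f₁ =ᵐ[haar] f₁') (h₂ : f₂ =ᵐ[haar] f₂') (x : SE2) :
    (fun g => periodization f₁ (toCoset g) * f₂ (g⁻¹ * x)) =ᵐ[haar]
      fun g => periodization f₁' (toCoset g) * f₂' (g⁻¹ * x) :=
  (periodization_comp_congr h₁).mul (ae_inv_mul_eq h₂ x)

theorem conv_congr (h₁ : f₁ =ᵐ[haar] f₁') (h₂ : f₂ =ᵐ[haar] f₂') : conv f₁ f₂ = conv f₁' f₂' :=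
  funext fun x => integral_congr_ae (conv_integrand_congr h₁ h₂ x)

theorem cosetConv_congr (h₁ : f₁ =ᵐ[haar] f₁') (h₂ : f₂ =ᵐ[haar] f₂') :
    cosetConv (periodization f₁) f₂ = cosetConv (periodization f₁') f₂' := by
  funext x
  induction x using Quotient.inductionOn with | h g => ?_
  exact integral_congr_ae (cosetConv_integrand_congr h₁ h₂ g)

theorem coeffIntegrand_congr (hi₁ : Integrable f₁ haar) (hi₂ : Integrable f₂ haar)
    (h₁ : f₁ =ᵐ[haar] f₁') (h₂ : f₂ =ᵐ[haar] f₂') (K : Set SE2) (ψ : Coset → ℂ) (n m k : ℤ) :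
    coeffIntegrand K ψ f₁ f₂ n m k = coeffIntegrand K ψ f₁' f₂' n m k := by
  funext p
  rw [coeffIntegrand, coeffIntegrand, fourierEntry_congr hi₁ h₁, fourierEntry_congr hi₂ h₂]

end SE2

end

open SE2 in
theorem mainTheorem8 {ι : Type*} (ψ : HilbertBasis ι ℂ (Lp ℂ 2 cosetMeasure))
    (f₁ f₂ : SE2 → ℂ) (hf₁ : Integrable f₁ haar) (hf₂ : Integrable f₂ haar)
    (hper : MemLp (absPeriodization f₁) 2 cosetMeasure) :
    -- the convolution `f₁ ⋆ f₂` and the estimate for the periodization of its absolute value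
    (∀ᵐ h ∂haar, Integrable (fun g => f₁ g * f₂ (g⁻¹ * h)) haar) ∧
    Integrable (conv f₁ f₂) haar ∧
    MemLp (absPeriodization (conv f₁ f₂)) 2 cosetMeasure ∧
    eLpNorm (absPeriodization (conv f₁ f₂)) 2 cosetMeasure ≤
      eLpNorm (absPeriodization f₁) 2 cosetMeasure * eLpNorm f₂ 1 haar ∧
    -- the integral that defines `f̃₁ ⊘ f₂` converges almost everywhere
    (∀ᵐ g ∂haar, Integrable
      (fun h => periodization f₁ (toCoset h) * f₂ (h⁻¹ * g)) haar) ∧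
    -- convergence of the integrals and of the iterated sums in the coefficients
    (∀ (ℓ : ι) (K : Set SE2), IsCompact K →
      (∀ n m k : ℤ, IntegrableOn (coeffIntegrand K (ψ ℓ) f₁ f₂ n m k) (Set.Ioi 0)) ∧
      (∀ n m : ℤ, Summable fun k : ℤ => coeffTerm K (ψ ℓ) f₁ f₂ n m k) ∧
      Summable fun q : ℤ × ℤ => ∑' k : ℤ, coeffTerm K (ψ ℓ) f₁ f₂ q.1 q.2 k) ∧
    -- the expansion
    ∃ (hmem : MemLp (cosetConv (periodization f₁) f₂) 2 cosetMeasure) (c : ι → ℂ),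
      (∀ (ℓ : ι) (K : ℕ → Set SE2), IsExhaustion K →
        Tendsto (fun j => ∑' n : ℤ, ∑' m : ℤ, ∑' k : ℤ, coeffTerm (K j) (ψ ℓ) f₁ f₂ n m k)
          atTop (𝓝 (c ℓ))) ∧
      HasSum (fun ℓ => c ℓ • ψ ℓ) hmem.toLp := by
  -- Measurable representatives leave both convolutions and all coefficients unchanged, and change
  -- the absolute periodization only on a null set.
  obtain ⟨F₁, hF₁, h₁⟩ : ∃ F₁, Measurable F₁ ∧ f₁ =ᵐ[haar] F₁ :=
    ⟨_, hf₁.1.stronglyMeasurable_mk.measurable, hf₁.1.ae_eq_mk⟩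
  obtain ⟨F₂, hF₂, h₂⟩ : ∃ F₂, Measurable F₂ ∧ f₂ =ᵐ[haar] F₂ :=
    ⟨_, hf₂.1.stronglyMeasurable_mk.measurable, hf₂.1.ae_eq_mk⟩
  have hi₁ : Integrable F₁ haar := hf₁.congr h₁
  have hi₂ : Integrable F₂ haar := hf₂.congr h₂
  have hper' : MemLp (absPeriodization F₁) 2 cosetMeasure :=
    hper.ae_eq (absPeriodization_congr h₁)
  have hterm : ∀ K (φ : Coset → ℂ) n m k, coeffTerm K φ f₁ f₂ n m k
      = coeffTerm K φ F₁ F₂ n m k := fun K φ n m k => by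
    rw [coeffTerm, coeffTerm, coeffIntegrand_congr hf₁ hf₂ h₁ h₂]
  have hconv := memLp_absPeriodization_conv hF₁ hF₂ hi₂ hper'
  have hψ : ∀ ℓ, Measurable (ψ ℓ) := fun ℓ => (Lp.stronglyMeasurable (ψ ℓ)).measurable
  have hL : ∀ ℓ, MemLp (ψ ℓ) 2 cosetMeasure := fun ℓ => Lp.memLp (ψ ℓ)
  have hL₁ := memLp_of_absPeriodization hF₁ hper'
  simp only [hterm, coeffIntegrand_congr hf₁ hf₂ h₁ h₂, cosetConv_congr h₁ h₂, conv_congr h₁ h₂,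
    eLpNorm_congr_ae (absPeriodization_congr h₁), eLpNorm_congr_ae h₂]
  refine ⟨?_, integrable_conv hF₁ hF₂ hi₁ hi₂, hconv.1, hconv.2, ?_, fun ℓ K hK => ⟨?_, ?_, ?_⟩,
    expansion_of_measurable ψ hF₁ hF₂ hi₁ hi₂ hper'⟩
  · filter_upwards [ae_integrable_conv hF₁ hF₂ hi₁ hi₂] with x hx
    exact hx.congr (conv_integrand_congr h₁ h₂ x).symm
  · filter_upwards [quasiMeasurePreserving_toCoset.ae (ae_cosetLConv_lt_top
      (measurable_absPeriodization hF₁) hF₂.enorm hper'.2.ne hi₂.2.ne)] with x hx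
    exact (integrable_cosetConv hF₁ hF₂ hi₁ hx).congr (cosetConv_integrand_congr h₁ h₂ x).symm
  · exact integrableOn_coeffIntegrand hF₁ hF₂ hi₁ hi₂ hL₁ hK (hψ ℓ) (hL ℓ)
  · exact fun n m => (hasSum_coeffTerm hF₁ hF₂ hi₁ hi₂ hL₁ hK (hψ ℓ) (hL ℓ) n m).summable
  · exact (hasSum_tsum_coeffTerm hF₁ hF₂ hi₁ hi₂ hper' hK (hψ ℓ) (hL ℓ)).summable
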